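/- **Setting.** Let $\mathcal N$ be a single-qubit quantum channel (linear, completely positive, trace preserving) that is not a unitary channel $A\mapsto UAU^\dagger$. Let $$\Phi=\mathcal V^{\mathrm{single}}\circ\mathcal N^{\otimes n}\circ\mathcal U_L\circ\cdots\circ\mathcal N^{\otimes n}\circ\mathcal U_1$$ be a noisy random circuit on $n$ qubits of depth $L\ge 1$. Here each $\mathcal U_l=U_l(\cdot)U_l^\dagger$, where $U_l$ is a product of finitely many two-qubit gates acting on arbitrary pairs of distinct qubits such that every qubit is acted on by at least one gate of the layer, each gate being drawn from a unitary 2-design on $\mathrm U(4)$; $\mathcal V^{\mathrm{single}}=V(\cdot)V^\dagger$ with $V=\bigotimes_{i=1}^n u_i$, each $u_i$ being drawn from a unitary 2-design on $\mathrm U(2)$; all gates are independent, and $\mathbb E$ is the expectation over them. A probability distribution $\nu$ on $\mathrm U(d)$ is a 2-design if $\mathbb E_{U\sim\nu}[U^{\otimes2}OU^{\dagger\otimes2}]$ equals the same expectation over the Haar measure for every operator $O$ on $(\mathbb C^d)^{\otimes 2}$. For $P\in\{I,X,Y,Z\}^{\otimes n}$, the weight $|P|$ is the number of tensor factors of $P$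 different from $I$, and $\|A\|_1=\operatorname{Tr}\sqrt{A^\dagger A}$. Vectors $t,D\in\mathbb R^3$ are normal form parameters of $\mathcal N$ if $\mathcal N(A)=U\mathcal N'(V^\dagger AV)U^\dagger$ for some unitaries $U,V$ and a channel $\mathcal N'$ with $\mathcal N'(I)=I+t_XX+t_YY+t_ZZ$ and $\mathcal N'(Q)=D_QQ$ for $Q\in\{X,Y,Z\}$; put $c=\frac13(\|t\|_2^2+\|D\|_2^2)$. **Theorem (Average distance between two quantum states).** 1. There are constants $a>0$ and $m_0\in\mathbb N$, depending only on $\mathcal N$, such that for all $n$, all $L\ge1$, every random circuit $\Phi$ as above, all $n$-qubit states $\rho,\sigma$ and all $P\in\{I,X,Y,Z\}^{\otimes n}$ with $L+|P|\ge m_0$, $$\mathbb E\big[\,|\operatorname{Tr}(P\Phi(\rho))-\operatorname{Tr}(P\Phi(\sigma))|\,\big]\le \exp(-a(L+|P|)).$$ 2. For all normal form parameters $t,D$ of $\mathcal N$ one has $c<1$, and for all $n$, all $L\ge 1$, every $\Phi$ and all states $\rho,\sigma$, $$\mathbb E\big[\|\Phi(\rho)-\Phi(\sigma)\|_1\big]\le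 2^{n+1}c^{\frac{L-1}{2}}.$$ 3. Consequently, at linear depth the average trace distance is exponentially small in $n$: there are constants $K,\gamma>0$, depending only on $\mathcal N$, such that for all $n$, all $L\ge 1$ with $L\ge Kn$, every $\Phi$ and all states $\rho,\sigma$, $$\mathbb E\big[\|\Phi(\rho)-\Phi(\sigma)\|_1\big]\le \exp(-\gamma n).$$ -/

import Mathlib

open Matrix MeasureTheory
open scoped Kronecker ComplexOrder

noncomputable section

namespace NoisyCircuit

/-! ### The unitary group as a compact measurable group -/

instance instMeasurableSpaceUnitaryGroup {d : Type} [Fintype d] [DecidableEq d] :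
    MeasurableSpace (unitaryGroup d ℂ) := borel _

instance instBorelSpaceUnitaryGroup {d : Type} [Fintype d] [DecidableEq d] :
    BorelSpace (unitaryGroup d ℂ) := ⟨rfl⟩

instance instCompactSpaceUnitaryGroup {d : Type} [Fintype d] [DecidableEq d] :
    CompactSpace (unitaryGroup d ℂ) := by
  refine isCompact_iff_compactSpace.mp ?_
  have hK : IsCompact {M : Matrix d d ℂ | ∀ i j, M i j ∈ Metric.closedBall (0 : ℂ) 1} := by
    have h := isCompact_univ_pi (X := fun _ : d => d → ℂ)
      (s := fun _ => Set.univ.pi fun _ => Metric.closedBall (0 : ℂ) 1)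
      (fun _ => isCompact_univ_pi fun _ => isCompact_closedBall 0 1)
    have e : {M : Matrix d d ℂ | ∀ i j, M i j ∈ Metric.closedBall (0 : ℂ) 1} =
        (Set.univ.pi fun _ : d => Set.univ.pi fun _ : d => Metric.closedBall (0 : ℂ) 1) := by
      refine Set.ext fun M => ?_
      exact ⟨fun h i _ j _ => h i j, fun h i j => h i trivial j trivial⟩
    rw [e]
    exact h
  refine hK.of_isClosed_subset ?_ ?_
  · have : ((unitaryGroup d ℂ : Submonoid (Matrix d d ℂ)) : Set (Matrix d d ℂ))
        = {M | star M * M = 1} := by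
      ext M
      exact mem_unitaryGroup_iff'
    rw [this]
    exact isClosed_eq (by fun_prop) continuous_const
  · intro M hM i j
    simpa using entry_norm_bound_of_unitary hM i j

/-- The Haar probability measure on the unitary group `U(d)`. -/
def haarUnitary (d : Type) [Fintype d] [DecidableEq d] : Measure (unitaryGroup d ℂ) :=
  Measure.haarMeasure ⊤

/-- A probability distribution `ν` on `U(d)` is a unitary 2-design if
`𝔼_{U ∼ ν} [U^{⊗2} O (U^{⊗2})†] = 𝔼_{U ∼ Haar} [U^{⊗2} O (U^{⊗2})†]` for every operator `O`
on `ℂ^d ⊗ ℂ^d` (the expectations are taken entry by entry). -/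
def IsTwoDesign {d : Type} [Fintype d] [DecidableEq d] (ν : Measure (unitaryGroup d ℂ)) : Prop :=
  IsProbabilityMeasure ν ∧
    ∀ (O : Matrix (d × d) (d × d) ℂ) (i j : d × d),
      ∫ U, (((U : Matrix d d ℂ) ⊗ₖ (U : Matrix d d ℂ)) * O *
          ((U : Matrix d d ℂ) ⊗ₖ (U : Matrix d d ℂ))ᴴ) i j ∂ν =
        ∫ U, (((U : Matrix d d ℂ) ⊗ₖ (U : Matrix d d ℂ)) * O *
          ((U : Matrix d d ℂ) ⊗ₖ (U : Matrix d d ℂ))ᴴ) i j ∂(haarUnitary d)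

/-! ### Operators, states, Pauli strings, trace norm -/

/-- Operators on `n` qubits, in the computational basis `Fin n → Fin 2`. -/
abbrev Op (n : ℕ) := Matrix (Fin n → Fin 2) (Fin n → Fin 2) ℂ

/-- Density matrices. -/
def IsState {d : Type} [Fintype d] (ρ : Matrix d d ℂ) : Prop :=
  ρ.PosSemidef ∧ ρ.trace = 1

/-- The single-qubit Pauli basis `I, X, Y, Z`, indexed by `0, 1, 2, 3`. -/
def pauli : Fin 4 → Matrix (Fin 2) (Fin 2) ℂ :=
  ![1, !![0, 1; 1, 0], !![0, -Complex.I; Complex.I, 0], !![1, 0; 0, -1]]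

/-- The tensor product `A₁ ⊗ ⋯ ⊗ Aₙ` of single-qubit operators. -/
def tensor {n : ℕ} (A : Fin n → Matrix (Fin 2) (Fin 2) ℂ) : Op n :=
  Matrix.of fun x y => ∏ i, A i (x i) (y i)

/-- The Pauli string with `i`-th tensor factor `pauli (P i)`. -/
def pauliString {n : ℕ} (P : Fin n → Fin 4) : Op n :=
  tensor fun i => pauli (P i)

/-- The Pauli weight `|P|`: the number of tensor factors different from the identity. -/
def pauliWeight {n : ℕ} (P : Fin n → Fin 4) : ℕ :=
  (Finset.univ.filter fun i => P i ≠ 0).card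

/-- The trace norm (Schatten 1-norm): the sum of the singular values of `A`, that is of the
square roots of the eigenvalues of `A† A`. -/
def traceNorm {d : Type} [Fintype d] [DecidableEq d] (A : Matrix d d ℂ) : ℝ :=
  ∑ i, Real.sqrt ((isHermitian_conjTranspose_mul_self A).eigenvalues i)

/-! ### Single-qubit channels -/

/-- The action of `N ⊗ id` on operators on `ℂ^d ⊗ ℂ^D`. -/
def ampliate {d : Type} (N : Matrix d d ℂ →ₗ[ℂ] Matrix d d ℂ) (D : ℕ)
    (S : Matrix (d × Fin D) (d × Fin D) ℂ) : Matrix (d × Fin D) (d × Fin D) ℂ :=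
  Matrix.of fun p q => N (Matrix.of fun i j => S (i, p.2) (j, q.2)) p.1 q.1

/-- Quantum channels: linear, completely positive, trace-preserving maps. -/
structure IsChannel {d : Type} [Fintype d] (N : Matrix d d ℂ →ₗ[ℂ] Matrix d d ℂ) : Prop where
  completely_positive : ∀ (D : ℕ) (S : Matrix (d × Fin D) (d × Fin D) ℂ),
    S.PosSemidef → (ampliate N D S).PosSemidef
  trace_preserving : ∀ A, (N A).trace = A.trace

/-- The channel is a unitary channel `A ↦ U A U†`. -/
def IsUnitaryChannel {d : Type} [Fintype d] [DecidableEq d]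
    (N : Matrix d d ℂ →ₗ[ℂ] Matrix d d ℂ) : Prop :=
  ∃ U : unitaryGroup d ℂ, ∀ A, N A = (U : Matrix d d ℂ) * A * (U : Matrix d d ℂ)ᴴ

/-- `t = (t_X, t_Y, t_Z)` and `D = (D_X, D_Y, D_Z)` are normal form parameters of the single-qubit
channel `N`: there are unitaries `U`, `V` and a channel `N'` with `N(A) = U N'(V† A V) U†`, where
`N'(I) = I + t_X X + t_Y Y + t_Z Z` and `N'(Q) = D_Q Q` for `Q ∈ {X, Y, Z}`. -/
def IsNormalForm (N : Matrix (Fin 2) (Fin 2) ℂ →ₗ[ℂ] Matrix (Fin 2) (Fin 2) ℂ)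
    (t D : Fin 3 → ℝ) : Prop :=
  ∃ (U V : unitaryGroup (Fin 2) ℂ)
    (N' : Matrix (Fin 2) (Fin 2) ℂ →ₗ[ℂ] Matrix (Fin 2) (Fin 2) ℂ),
    IsChannel N' ∧
    (∀ A, N A = (U : Matrix (Fin 2) (Fin 2) ℂ) *
      N' ((V : Matrix (Fin 2) (Fin 2) ℂ)ᴴ * A * (V : Matrix (Fin 2) (Fin 2) ℂ)) *
      (U : Matrix (Fin 2) (Fin 2) ℂ)ᴴ) ∧
    N' 1 = 1 + ∑ q : Fin 3, (t q : ℂ) • pauli q.succ ∧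
    ∀ q : Fin 3, N' (pauli q.succ) = (D q : ℂ) • pauli q.succ

/-- The noise parameter `c = (‖t‖₂² + ‖D‖₂²) / 3`. -/
def noiseParam (t D : Fin 3 → ℝ) : ℝ :=
  (1 / 3) * (∑ q, t q ^ 2 + ∑ q, D q ^ 2)

/-- The `n`-fold tensor power `N^{⊗n}` of a single-qubit map: the linear map that sends the matrix
unit `⨂ᵢ |xᵢ⟩⟨yᵢ|` to `⨂ᵢ N(|xᵢ⟩⟨yᵢ|)`. -/
def tensorPower (N : Matrix (Fin 2) (Fin 2) ℂ →ₗ[ℂ] Matrix (Fin 2) (Fin 2) ℂ) {n : ℕ}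
    (A : Op n) : Op n :=
  ∑ x, ∑ y, A x y • tensor fun i => N (Matrix.single (x i) (y i) 1)

/-! ### Random circuits -/

/-- The `n`-qubit operator that acts as the two-qubit gate `G` on the qubits `a`, `b` (in this
order) and as the identity on all other qubits. -/
def embedGate {n : ℕ} (a b : Fin n) (G : Matrix (Fin 2 × Fin 2) (Fin 2 × Fin 2) ℂ) : Op n :=
  Matrix.of fun x y =>
    if ∀ k, k ≠ a → k ≠ b → x k = y k then G (x a, x b) (y a, y b) else 0

/-- A 2-local 2-design layer distribution on `n` qubits: finitely many two-qubit gates, acting on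
arbitrary pairs of distinct qubits (several gates may act on the same qubit), such that every qubit
is acted on by at least one gate, together with a 2-design on `U(4)` for each gate. -/
structure LayerDistribution (n : ℕ) where
  numGates : ℕ
  fst : Fin numGates → Fin n
  snd : Fin numGates → Fin n
  fst_ne_snd : ∀ j, fst j ≠ snd j
  covers : ∀ q, ∃ j, fst j = q ∨ snd j = q
  law : Fin numGates → Measure (unitaryGroup (Fin 2 × Fin 2) ℂ)
  isTwoDesign : ∀ j, IsTwoDesign (law j)

/-- The distribution of the gates of a random circuit on `n` qubits with `L` two-local layers and a
final layer of single-qubit gates, each of them drawn from a single-qubit 2-design. -/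
structure CircuitDistribution (n L : ℕ) where
  layer : Fin L → LayerDistribution n
  finalLaw : Fin n → Measure (unitaryGroup (Fin 2) ℂ)
  final_isTwoDesign : ∀ i, IsTwoDesign (finalLaw i)

variable {n L : ℕ}

/-- A choice of all the gates of the circuit. -/
abbrev CircuitDistribution.Gates (E : CircuitDistribution n L) : Type :=
  (∀ l : Fin L, Fin (E.layer l).numGates → unitaryGroup (Fin 2 × Fin 2) ℂ) ×
    (Fin n → unitaryGroup (Fin 2) ℂ)

/-- The law of the circuit: all gates are drawn independently. -/
def CircuitDistribution.measure (E : CircuitDistribution n L) : Measure E.Gates :=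
  (Measure.pi fun l => Measure.pi (E.layer l).law).prod (Measure.pi E.finalLaw)

/-- The unitary of a layer of gates: the product of its gates, in the order of the list. -/
def LayerDistribution.unitary (Λ : LayerDistribution n)
    (g : Fin Λ.numGates → unitaryGroup (Fin 2 × Fin 2) ℂ) : Op n :=
  (List.ofFn fun j => embedGate (Λ.fst j) (Λ.snd j) (g j : Matrix _ _ ℂ)).prod

/-- The noisy circuit
`Φ = 𝒱^{single} ∘ N^{⊗n} ∘ 𝒰_L ∘ ⋯ ∘ N^{⊗n} ∘ 𝒰_1` for given gates `g`. -/
def CircuitDistribution.circuit (E : CircuitDistribution n L)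
    (N : Matrix (Fin 2) (Fin 2) ℂ →ₗ[ℂ] Matrix (Fin 2) (Fin 2) ℂ) (g : E.Gates) (A : Op n) : Op n :=
  tensor (fun i => (g.2 i : Matrix (Fin 2) (Fin 2) ℂ)) *
    Fin.foldl L
      (fun B l => tensorPower N ((E.layer l).unitary (g.1 l) * B * ((E.layer l).unitary (g.1 l))ᴴ))
      A *
    (tensor (fun i => (g.2 i : Matrix (Fin 2) (Fin 2) ℂ)))ᴴ

end NoisyCircuit

end

open NoisyCircuit

set_option linter.unusedSectionVars false

noncomputable section

namespace NoisyCircuit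

/-! ### Haar measure on the unitary group -/

section Haar

variable {d : Type} [Fintype d] [DecidableEq d]

/-! Write operators in the Pauli basis. A circuit then acts linearly on the vector `v` of Pauli
coefficients of `ρ - σ`, and all bounds follow from the second moment `A = 𝔼[v v†]`, which is
propagated through the circuit one independent factor at a time (`secondMoment_prod`,
`secondMoment_prod_swap`).

For a 2-design, the second moments of the real coefficients of `A ↦ U A U†` are those of the Haar
measure (`IsTwoDesign.moment`). Translation by basis elements flips signs and kills all mixed
moments. Translation by the Hermitian unitary `(P + P₁)/√2`, with `P`, `P₁` anticommuting, makes the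
others equal. So an averaged gate fixes the identity on its qubits and sends every other Pauli
string there to the uniform mixture of the non-identity ones.

Two facts about `A` are tracked. `IsUniformOn`: once each qubit has been hit by a gate of the layer,
`A` is diagonal and its diagonal depends only on supports. `IsBoundedBy`: the averages of the
diagonal over strings of equal support (`twirl`) are at most `K`, and the entry at the identity is
nonpositive, initially because `ρ - σ` is traceless. The noise can destroy the first property, which
the next layer restores. The second survives gates, because gate averages are stochastic and commute
with the twirl. It improves under noise: on a uniform `A` the twirled noise factorises over the
qubits, with factor `1` at an identity and `c = contraction N` elsewhere
(`IsUniformOn.twirl_noise_le`). Every layer but the last thus gains a factor `c`, the last one gains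
`c ^ |P|`, and the final single-qubit gates turn diagonal entries into twirled ones. The mean square
of a Pauli coefficient is at most `4 c ^ (L - 1 + |P|)`.

That `c < 1` holds because `1 + 3c` is the squared Frobenius norm of the Choi matrix, a positive
matrix of trace `2`. Hence `1 + 3c ≤ 4`, and equality would force rank one, that is a unitary
channel. This norm is invariant under unitary changes of input and output, so `c` equals the noise
parameter of every normal form. Jensen's inequality, and `‖A‖₁² ≤ 2ⁿ ‖A‖₂² = ∑_P |Tr(P A)|²` for the
trace norm, finish the proof. -/

instance instSecondCountableTopologyUnitaryGroup :
    SecondCountableTopology (unitaryGroup d ℂ) := by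
  have : SecondCountableTopology (Matrix d d ℂ) :=
    inferInstanceAs (SecondCountableTopology (d → d → ℂ))
  exact TopologicalSpace.Subtype.secondCountableTopology _

instance instIsHaarMeasureHaarUnitary : (haarUnitary d).IsHaarMeasure :=
  inferInstanceAs (Measure.haarMeasure ⊤).IsHaarMeasure

instance instIsProbabilityMeasureHaarUnitary : IsProbabilityMeasure (haarUnitary d) :=
  ⟨Measure.haarMeasure_self (K₀ := ⊤)⟩

/-- A compact group is unimodular: a right translate of the Haar probability measure is again a Haar
probability measure, hence the same one. -/
instance instIsMulRightInvariantHaarUnitary : (haarUnitary d).IsMulRightInvariant := by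
  refine ⟨fun W => ?_⟩
  have : IsProbabilityMeasure (Measure.map (· * W) (haarUnitary d)) :=
    Measure.isProbabilityMeasure_map (measurable_mul_const W).aemeasurable
  exact Measure.isHaarMeasure_eq_of_isProbabilityMeasure _ _

/-- A continuous function on a compact space is integrable for every finite measure. -/
theorem integrable_of_continuous {X : Type*} [TopologicalSpace X] [CompactSpace X]
    [MeasurableSpace X] [OpensMeasurableSpace X] {E : Type*} [NormedAddCommGroup E]
    {μ : Measure X} [IsFiniteMeasure μ]
    {f : X → E} (hf : Continuous f) : Integrable f μ :=
  hf.integrable_of_hasCompactSupport (HasCompactSupport.of_compactSpace f)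

end Haar

/-! ### Pauli-type operator bases -/

section PauliBasis

variable {d ι : Type} [Fintype d] [DecidableEq d] [Fintype ι] [DecidableEq ι] [Zero ι]

/-- An operator basis of Hermitian unitaries that contains the identity and whose elements
pairwise commute or anticommute, according to a sign that separates any two elements and that
connects any two elements other than the identity. -/
structure IsPauliBasis (b : ι → Matrix d d ℂ) (s : ι → ι → ℤ) : Prop where
  zero : b 0 = 1
  herm : ∀ i, (b i)ᴴ = b i
  sq : ∀ i, b i * b i = 1
  comm : ∀ i j, b i * b j = s i j • (b j * b i)
  sign : ∀ i j, s i j = 1 ∨ s i j = -1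
  separates : ∀ i j, i ≠ j → ∃ k, s k i ≠ s k j
  connects : ∀ i j, i ≠ 0 → j ≠ 0 → ∃ k, k ≠ 0 ∧ s i k = -1 ∧ s k j = -1
  complete : ∀ x y z w, ∑ i, b i x y * b i z w = if x = w ∧ y = z then (Fintype.card d : ℂ) else 0

/-- The matrix of `A ↦ U A U†` in the operator basis `b`. -/
def conjCoeff (b : ι → Matrix d d ℂ) (U : Matrix d d ℂ) (P Q : ι) : ℂ :=
  (b P * U * b Q * Uᴴ).trace / Fintype.card d

/-- The stochastic matrix that fixes the index `0` and makes all the others uniform. -/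
def uniformKernel (p q : ι) : ℝ :=
  if p = 0 then (if q = 0 then 1 else 0) else if q = 0 then 0 else 1 / ((Fintype.card ι : ℝ) - 1)

variable {b : ι → Matrix d d ℂ} {s : ι → ι → ℤ}

section Complete

variable {κ : Type} [Fintype κ] {e : κ → Matrix d d ℂ} {D : ℂ}

/-- The hypothesis says that `∑ eᵢ ⊗ eᵢ` is `D` times the swap, and contracting with `A` gives the
expansion. It is kept free of the commutation structure so that it also covers Pauli strings, with
`D = 2 ^ n`. -/
theorem sum_trace_smul_of_complete
    (h : ∀ x y z w, ∑ i, e i x y * e i z w = if x = w ∧ y = z then D else 0) (A : Matrix d d ℂ) :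
    ∑ i, (e i * A).trace • e i = D • A := by
  ext x y
  simp only [Matrix.sum_apply, Matrix.smul_apply, trace, diag, Matrix.mul_apply, smul_eq_mul,
    Finset.sum_mul]
  rw [Finset.sum_comm]
  have : ∀ z, ∑ i, ∑ w, e i z w * A w z * e i x y
      = ∑ w, A w z * ∑ i, e i z w * e i x y := by
    intro z
    rw [Finset.sum_comm]
    refine Finset.sum_congr rfl fun w _ => ?_
    rw [Finset.mul_sum]
    exact Finset.sum_congr rfl fun i _ => by ring
  simp only [this, h]
  have h2 : ∀ z w, A w z * (if z = y ∧ w = x then D else 0)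
      = if z = y then (if w = x then A w z * D else 0) else 0 := by
    intro z w; split_ifs <;> simp_all
  simp only [h2]
  simp [mul_comm]

/-- Parseval's identity. -/
theorem sum_trace_mul_star_of_complete (he : ∀ i, (e i)ᴴ = e i)
    (h : ∀ x y z w, ∑ i, e i x y * e i z w = if x = w ∧ y = z then D else 0) (A : Matrix d d ℂ) :
    ∑ i, (e i * A).trace * star (e i * A).trace = D * (Aᴴ * A).trace := by
  have h1 : ∀ i, star (e i * A).trace = (Aᴴ * e i).trace := by
    intro i
    rw [← trace_conjTranspose, conjTranspose_mul, he]
  calc _ = (Aᴴ * ∑ i, (e i * A).trace • e i).trace := by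
        simp only [h1, Finset.mul_sum, trace_sum, mul_smul_comm, trace_smul, smul_eq_mul]
    _ = _ := by rw [sum_trace_smul_of_complete h, mul_smul_comm, trace_smul, smul_eq_mul]

end Complete

namespace IsPauliBasis

theorem sum_trace_smul (hb : IsPauliBasis b s) (A : Matrix d d ℂ) :
    ∑ i, (b i * A).trace • b i = (Fintype.card d : ℂ) • A :=
  sum_trace_smul_of_complete hb.complete A

/-- Conjugation by a basis element whose signs separate `i` and `j` preserves the trace and negates
the product, so the trace of the product vanishes. -/
theorem trace_mul (hb : IsPauliBasis b s) (i j : ι) :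
    (b i * b j).trace = if i = j then (Fintype.card d : ℂ) else 0 := by
  split_ifs with h
  · rw [h, hb.sq, trace_one]
  · obtain ⟨k, hk⟩ := hb.separates i j h
    have h1 : (b i * b j).trace = (b k * (b i * b j) * b k).trace := by
      rw [trace_mul_comm (b k * (b i * b j)), ← mul_assoc, hb.sq, one_mul]
    have h2 : b k * (b i * b j) * b k = (s k i * s k j) • (b i * b j) := by
      rw [← mul_assoc, hb.comm k i, smul_mul_assoc, smul_mul_assoc, mul_assoc, mul_assoc,
        ← mul_assoc (b k), hb.comm k j, smul_mul_assoc, mul_assoc (b j), hb.sq, mul_one,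
        mul_smul_comm, smul_smul]
    have h3 : s k i * s k j = -1 := by
      rcases hb.sign k i with h | h <;> rcases hb.sign k j with h' | h' <;> simp_all
    rw [h2, h3, neg_one_zsmul, trace_neg] at h1
    exact CharZero.eq_neg_self_iff.mp h1

theorem star_conjCoeff (hb : IsPauliBasis b s) (U : Matrix d d ℂ) (P Q : ι) :
    star (conjCoeff b U P Q) = conjCoeff b U P Q := by
  unfold conjCoeff
  rw [star_div₀, ← trace_conjTranspose]
  simp only [conjTranspose_mul, conjTranspose_conjTranspose, hb.herm, star_natCast]
  rw [← mul_assoc, ← mul_assoc, trace_mul_comm, ← mul_assoc, ← mul_assoc]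

/-- Heisenberg picture: the row `P` of the coefficient matrix expands the observable pulled back
along the unitary. -/
theorem conj_eq_sum (hb : IsPauliBasis b s) [Nonempty d] (U : Matrix d d ℂ) (P : ι) :
    Uᴴ * b P * U = ∑ Q, conjCoeff b U P Q • b Q := by
  have h := hb.sum_trace_smul (Uᴴ * b P * U)
  have : ∀ Q, (b Q * (Uᴴ * b P * U)).trace = Fintype.card d * conjCoeff b U P Q := by
    intro Q
    rw [conjCoeff, mul_div_cancel₀ _ (Nat.cast_ne_zero.mpr Fintype.card_ne_zero), trace_mul_comm,
      mul_assoc, mul_assoc, trace_mul_comm]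
    simp only [mul_assoc]
  simp only [this, mul_smul, ← Finset.smul_sum] at h
  exact (smul_right_injective _ (Nat.cast_ne_zero.mpr Fintype.card_ne_zero) h).symm

variable [Nonempty d]

theorem conjCoeff_zero_left (hb : IsPauliBasis b s) {U : Matrix d d ℂ} (hU : U * Uᴴ = 1) (Q : ι) :
    conjCoeff b U 0 Q = if Q = 0 then 1 else 0 := by
  have hU' : Uᴴ * U = 1 := mul_eq_one_comm.mp hU
  rw [conjCoeff, hb.zero, one_mul, mul_assoc, trace_mul_comm, mul_assoc, hU', mul_one,
    ← one_mul (b Q), ← hb.zero, hb.trace_mul]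
  simp only [eq_comm (a := (0 : ι))]
  split_ifs <;> simp

theorem conjCoeff_zero_right (hb : IsPauliBasis b s) {U : Matrix d d ℂ} (hU : U * Uᴴ = 1) (P : ι) :
    conjCoeff b U P 0 = if P = 0 then 1 else 0 := by
  rw [conjCoeff, hb.zero, mul_one, mul_assoc, hU, mul_one,
    ← mul_one (b P), ← hb.zero, hb.trace_mul]
  split_ifs <;> simp

/-- The pulled-back observable `U† P U` again squares to the identity; compare traces, using
orthogonality of the basis. -/
theorem sum_sq_conjCoeff (hb : IsPauliBasis b s) {U : Matrix d d ℂ} (hU : U * Uᴴ = 1) (P : ι) :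
    ∑ Q, conjCoeff b U P Q * conjCoeff b U P Q = 1 := by
  have h := hb.conj_eq_sum U P
  have h1 : ((Uᴴ * b P * U) * (Uᴴ * b P * U)).trace = Fintype.card d := by
    have : (Uᴴ * b P * U) * (Uᴴ * b P * U) = Uᴴ * (b P * (U * Uᴴ) * b P) * U := by
      simp only [mul_assoc]
    rw [this, hU, mul_one, hb.sq, mul_one, mul_eq_one_comm.mp hU, trace_one]
  rw [h, Finset.sum_mul] at h1
  simp only [Finset.mul_sum, trace_sum, smul_mul_assoc, mul_smul_comm, trace_smul, hb.trace_mul,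
    smul_eq_mul, mul_ite, mul_zero, Finset.sum_ite_eq, Finset.mem_univ, if_true] at h1
  simp only [← mul_assoc, ← Finset.sum_mul] at h1
  exact mul_right_cancel₀ (Nat.cast_ne_zero.mpr Fintype.card_ne_zero) (h1.trans (one_mul _).symm)

end IsPauliBasis

end PauliBasis

/-! ### Second moments of the Haar measure and of 2-designs -/

section HaarMoments

variable {d ι : Type} [Fintype d] [DecidableEq d] [Fintype ι] [DecidableEq ι] [Zero ι]
  {b : ι → Matrix d d ℂ} {s : ι → ι → ℤ}

theorem conjCoeff_mul_of_left {W U : Matrix d d ℂ} {P P₁ : ι} {ε : ℂ}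
    (h : Wᴴ * b P * W = ε • b P₁) (Q : ι) :
    conjCoeff b (W * U) P Q = ε * conjCoeff b U P₁ Q := by
  have : (b P * (W * U) * b Q * (W * U)ᴴ).trace = ((Wᴴ * b P * W) * U * b Q * Uᴴ).trace := by
    rw [conjTranspose_mul, ← mul_assoc, trace_mul_comm]
    simp only [mul_assoc]
  rw [conjCoeff, conjCoeff, this, h]
  simp only [smul_mul_assoc, trace_smul, smul_eq_mul, mul_div_assoc]

theorem conjCoeff_mul_of_right {W U : Matrix d d ℂ} {Q Q₁ : ι} {ε : ℂ}
    (h : W * b Q * Wᴴ = ε • b Q₁) (P : ι) :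
    conjCoeff b (U * W) P Q = ε * conjCoeff b U P Q₁ := by
  have : b P * (U * W) * b Q * (U * W)ᴴ = b P * U * (W * b Q * Wᴴ) * Uᴴ := by
    simp only [conjTranspose_mul, mul_assoc]
  rw [conjCoeff, conjCoeff, this, h]
  simp only [smul_mul_assoc, mul_smul_comm, trace_smul, smul_eq_mul, mul_div_assoc]

theorem continuous_conjCoeff (P Q : ι) :
    Continuous fun U : unitaryGroup d ℂ => conjCoeff b (U : Matrix d d ℂ) P Q := by
  unfold conjCoeff
  fun_prop

namespace IsPauliBasis

theorem conj_self (hb : IsPauliBasis b s) (k P : ι) : b k * b P * b k = (s k P : ℂ) • b P := by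
  rw [hb.comm, smul_mul_assoc, mul_assoc, hb.sq, mul_one, Int.cast_smul_eq_zsmul]

/-- The elements of a Pauli basis as elements of the unitary group. -/
def toUnitary (hb : IsPauliBasis b s) (k : ι) : unitaryGroup d ℂ :=
  ⟨b k, by rw [mem_unitaryGroup_iff, star_eq_conjTranspose, hb.herm, hb.sq]⟩

/-- Two anticommuting elements of a Pauli basis are conjugate under a Hermitian unitary. -/
theorem exists_conj_of_anticommute (hb : IsPauliBasis b s) {P P₁ : ι} (h : s P P₁ = -1) :
    ∃ W : unitaryGroup d ℂ, (W : Matrix d d ℂ)ᴴ = W ∧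
      (W : Matrix d d ℂ) * b P * W = b P₁ := by
  have hc : b P * b P₁ = -(b P₁ * b P) := by rw [hb.comm, h, neg_one_zsmul]
  -- The witness is the generalised Hadamard `(P + P₁)/√2`. It squares to the identity because the
  -- cross terms cancel, and it intertwines `P` with `P₁`.
  have hr : ((Real.sqrt 2 : ℂ)⁻¹) * (Real.sqrt 2 : ℂ)⁻¹ = 2⁻¹ := by
    rw [← mul_inv, ← Complex.ofReal_mul, Real.mul_self_sqrt (by norm_num)]; norm_num
  set r : ℂ := (Real.sqrt 2 : ℂ)⁻¹ with hrdef
  have hherm : (r • (b P + b P₁))ᴴ = r • (b P + b P₁) := by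
    rw [conjTranspose_smul, conjTranspose_add, hb.herm, hb.herm]
    congr 1
    simp [hrdef]
  have hsq : (r • (b P + b P₁)) * (r • (b P + b P₁)) = 1 := by
    rw [smul_mul_smul_comm, hr, add_mul, mul_add, mul_add, hb.sq, hb.sq, hc]
    have : (1 : Matrix d d ℂ) + -(b P₁ * b P) + (b P₁ * b P + 1) = (2 : ℂ) • 1 := by
      rw [two_smul]; abel
    rw [this, smul_smul]; norm_num
  have key : (r • (b P + b P₁)) * b P = b P₁ * (r • (b P + b P₁)) := by
    rw [smul_mul_assoc, mul_smul_comm, add_mul, mul_add, hb.sq, hb.sq, add_comm]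
  refine ⟨⟨r • (b P + b P₁), ?_⟩, hherm, ?_⟩
  · rw [mem_unitaryGroup_iff, star_eq_conjTranspose, hherm, hsq]
  · simp only [key, mul_assoc, hsq, mul_one]

/-- Left translation by a basis element that separates `P` from `P'` flips the sign of the
integrand, so by invariance the integral is its own negative. -/
theorem haar_moment_of_left_ne (hb : IsPauliBasis b s) {P P' : ι} (h : P ≠ P') (Q Q' : ι) :
    ∫ U : unitaryGroup d ℂ, conjCoeff b U P Q * conjCoeff b U P' Q' ∂haarUnitary d = 0 := by
  obtain ⟨k, hk⟩ := hb.separates P P' h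
  have h1 := integral_mul_left_eq_self (μ := haarUnitary d)
    (fun U : unitaryGroup d ℂ => conjCoeff b U P Q * conjCoeff b U P' Q') (hb.toUnitary k)
  have e : ∀ P, ((hb.toUnitary k : unitaryGroup d ℂ) : Matrix d d ℂ)ᴴ * b P * hb.toUnitary k
      = (s k P : ℂ) • b P := fun P => by
    simp only [toUnitary, hb.herm, hb.conj_self]
  have h2 : ∀ U : unitaryGroup d ℂ,
      conjCoeff b (hb.toUnitary k * U : unitaryGroup d ℂ) P Q *
        conjCoeff b (hb.toUnitary k * U : unitaryGroup d ℂ) P' Q'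
      = -(conjCoeff b U P Q * conjCoeff b U P' Q') := by
    intro U
    rw [Submonoid.coe_mul, conjCoeff_mul_of_left (e P), conjCoeff_mul_of_left (e P')]
    rcases hb.sign k P with h | h <;> rcases hb.sign k P' with h' | h' <;>
      simp_all
  simp only [h2, integral_neg] at h1
  exact (CharZero.eq_neg_self_iff.mp h1.symm)

theorem haar_moment_of_right_ne (hb : IsPauliBasis b s) {Q Q' : ι} (h : Q ≠ Q') (P P' : ι) :
    ∫ U : unitaryGroup d ℂ, conjCoeff b U P Q * conjCoeff b U P' Q' ∂haarUnitary d = 0 := by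
  obtain ⟨k, hk⟩ := hb.separates Q Q' h
  have h1 := integral_mul_right_eq_self (μ := haarUnitary d)
    (fun U : unitaryGroup d ℂ => conjCoeff b U P Q * conjCoeff b U P' Q') (hb.toUnitary k)
  have e : ∀ P, ((hb.toUnitary k : unitaryGroup d ℂ) : Matrix d d ℂ) * b P *
      (hb.toUnitary k : Matrix d d ℂ)ᴴ = (s k P : ℂ) • b P := fun P => by
    simp only [toUnitary, hb.herm, hb.conj_self]
  have h2 : ∀ U : unitaryGroup d ℂ,
      conjCoeff b (U * hb.toUnitary k : unitaryGroup d ℂ) P Q *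
        conjCoeff b (U * hb.toUnitary k : unitaryGroup d ℂ) P' Q'
      = -(conjCoeff b U P Q * conjCoeff b U P' Q') := by
    intro U
    rw [Submonoid.coe_mul, conjCoeff_mul_of_right (e Q), conjCoeff_mul_of_right (e Q')]
    rcases hb.sign k Q with h | h <;> rcases hb.sign k Q' with h' | h' <;>
      simp_all
  simp only [h2, integral_neg] at h1
  exact (CharZero.eq_neg_self_iff.mp h1.symm)

/-- Right translation by the unitary that carries one of two anticommuting elements to the other
equates their moments. Two non-identity elements need not anticommute, so an intermediate element
anticommuting with both is used. -/
theorem haar_moment_right_eq (hb : IsPauliBasis b s) {Q Q' : ι} (hQ : Q ≠ 0) (hQ' : Q' ≠ 0)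
    (P : ι) :
    ∫ U : unitaryGroup d ℂ, conjCoeff b U P Q * conjCoeff b U P Q ∂haarUnitary d =
      ∫ U : unitaryGroup d ℂ, conjCoeff b U P Q' * conjCoeff b U P Q' ∂haarUnitary d := by
  have step : ∀ {Q Q₁ : ι}, s Q Q₁ = -1 →
      ∫ U : unitaryGroup d ℂ, conjCoeff b U P Q * conjCoeff b U P Q ∂haarUnitary d =
      ∫ U : unitaryGroup d ℂ, conjCoeff b U P Q₁ * conjCoeff b U P Q₁ ∂haarUnitary d := by
    intro Q Q₁ h
    obtain ⟨W, hW, hW1⟩ := hb.exists_conj_of_anticommute h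
    have h1 := integral_mul_right_eq_self (μ := haarUnitary d)
      (fun U : unitaryGroup d ℂ => conjCoeff b U P Q * conjCoeff b U P Q) W
    have e : (W : Matrix d d ℂ) * b Q * (W : Matrix d d ℂ)ᴴ = (1 : ℂ) • b Q₁ := by
      rw [hW, hW1, one_smul]
    simp only [Submonoid.coe_mul, conjCoeff_mul_of_right e, one_mul] at h1
    exact h1.symm
  obtain ⟨k, -, h1, h2⟩ := hb.connects Q Q' hQ hQ'
  exact (step h1).trans (step h2)

/-- The second moments of the Haar measure in a Pauli basis. -/
theorem haar_moment (hb : IsPauliBasis b s) [Nonempty d] (P Q P' Q' : ι) :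
    ∫ U : unitaryGroup d ℂ, conjCoeff b U P Q * conjCoeff b U P' Q' ∂haarUnitary d =
      if P = P' ∧ Q = Q' then (uniformKernel P Q : ℂ) else 0 := by
  have hU : ∀ U : unitaryGroup d ℂ, (U : Matrix d d ℂ) * (U : Matrix d d ℂ)ᴴ = 1 := fun U =>
    mem_unitaryGroup_iff.mp U.2
  by_cases hP : P = P'
  swap
  · rw [hb.haar_moment_of_left_ne hP, if_neg (fun h => hP h.1)]
  by_cases hQ : Q = Q'
  swap
  · rw [hb.haar_moment_of_right_ne hQ, if_neg (fun h => hQ h.2)]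
  subst hP hQ
  rw [if_pos ⟨rfl, rfl⟩, uniformKernel]
  by_cases hP : P = 0
  · subst hP
    simp only [hb.conjCoeff_zero_left (hU _), if_true]
    split_ifs <;> simp
  by_cases hQ : Q = 0
  · subst hQ
    simp only [hb.conjCoeff_zero_right (hU _), if_neg hP]
    simp
  rw [if_neg hP, if_neg hQ]
  -- The row has total weight one, its entry at `0` vanishes and the other entries have equal
  -- moments; this yields the value `1 / (card ι - 1)`.
  have hsum : ∑ Q, ∫ U : unitaryGroup d ℂ, conjCoeff b U P Q * conjCoeff b U P Q ∂haarUnitary d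
      = 1 := by
    have hint : ∀ Q ∈ Finset.univ, Integrable (fun U : unitaryGroup d ℂ =>
        conjCoeff b U P Q * conjCoeff b U P Q) (haarUnitary d) := fun Q _ =>
      integrable_of_continuous ((continuous_conjCoeff P Q).mul (continuous_conjCoeff P Q))
    rw [← integral_finsetSum _ hint]
    simp only [hb.sum_sq_conjCoeff (hU _)]
    simp
  have h0 : ∫ U : unitaryGroup d ℂ, conjCoeff b U P 0 * conjCoeff b U P 0 ∂haarUnitary d = 0 := by
    simp only [hb.conjCoeff_zero_right (hU _), if_neg hP]
    simp
  rw [← Finset.add_sum_erase _ _ (Finset.mem_univ (0 : ι)), h0, zero_add,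
    Finset.sum_congr rfl fun Q' hQ' =>
      hb.haar_moment_right_eq (Finset.ne_of_mem_erase hQ') hQ P, Finset.sum_const,
    Finset.card_erase_of_mem (Finset.mem_univ _), Finset.card_univ, nsmul_eq_mul,
    Nat.cast_sub (Fintype.card_pos_iff.mpr ⟨0⟩)] at hsum
  push_cast at hsum ⊢
  exact eq_one_div_of_mul_eq_one_right hsum

end IsPauliBasis

/-- The second moments of a 2-design in a Pauli basis. -/
theorem IsTwoDesign.moment [Nonempty d] {ν : Measure (unitaryGroup d ℂ)} (hν : IsTwoDesign ν)
    (hb : IsPauliBasis b s) (P Q P' Q' : ι) :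
    ∫ U : unitaryGroup d ℂ, conjCoeff b U P Q * star (conjCoeff b U P' Q') ∂ν =
      if P = P' ∧ Q = Q' then (uniformKernel P Q : ℂ) else 0 := by
  have hp := hν.1
  simp only [hb.star_conjCoeff]
  rw [← hb.haar_moment P Q P' Q']
  -- The product of two coefficients is a fixed linear functional of `U^{⊗2} O U^{⊗2†}` with `O = b
  -- Q ⊗ b Q'`, so the 2-design property applies entry by entry.
  have e : ∀ U : unitaryGroup d ℂ, conjCoeff b U P Q * conjCoeff b U P' Q' =
      ∑ i : d × d, ∑ j : d × d, ((b P ⊗ₖ b P') i j / (Fintype.card d * Fintype.card d)) *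
        (((U : Matrix d d ℂ) ⊗ₖ (U : Matrix d d ℂ)) * (b Q ⊗ₖ b Q') *
          ((U : Matrix d d ℂ) ⊗ₖ (U : Matrix d d ℂ))ᴴ) j i := by
    intro U
    have : ∀ X Y : Matrix (d × d) (d × d) ℂ, ∑ i, ∑ j,
        (X i j / (Fintype.card d * Fintype.card d)) * Y j i
        = (X * Y).trace / (Fintype.card d * Fintype.card d) := by
      intro X Y
      simp only [trace, diag, Matrix.mul_apply, Finset.sum_div]
      exact Finset.sum_congr rfl fun i _ => Finset.sum_congr rfl fun j _ => by ring
    rw [this, conjTranspose_kronecker, ← mul_kronecker_mul, ← mul_kronecker_mul,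
      ← mul_kronecker_mul, trace_kronecker, conjCoeff, conjCoeff, div_mul_div_comm]
    simp only [mul_assoc]
  have hint : ∀ (μ : Measure (unitaryGroup d ℂ)) [IsProbabilityMeasure μ] (i j : d × d) (z : ℂ),
      Integrable (fun U : unitaryGroup d ℂ => z *
        (((U : Matrix d d ℂ) ⊗ₖ (U : Matrix d d ℂ)) * (b Q ⊗ₖ b Q') *
          ((U : Matrix d d ℂ) ⊗ₖ (U : Matrix d d ℂ))ᴴ) j i) μ := by
    intro μ _ i j z
    refine integrable_of_continuous (continuous_const.mul ?_)
    have hc : Continuous fun U : unitaryGroup d ℂ => (U : Matrix d d ℂ) ⊗ₖ (U : Matrix d d ℂ) := by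
      refine continuous_matrix fun i j => ?_
      exact (continuous_subtype_val.matrix_elem _ _).mul (continuous_subtype_val.matrix_elem _ _)
    exact ((hc.matrix_mul continuous_const).matrix_mul hc.matrix_conjTranspose).matrix_elem j i
  simp only [e]
  rw [integral_finsetSum _ fun i _ => integrable_finsetSum _ fun j _ => hint ν i j _,
    integral_finsetSum _ fun i _ => integrable_finsetSum _ fun j _ => hint _ i j _]
  refine Finset.sum_congr rfl fun i _ => ?_
  rw [integral_finsetSum _ fun j _ => hint ν i j _, integral_finsetSum _ fun j _ => hint _ i j _]
  refine Finset.sum_congr rfl fun j _ => ?_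
  rw [integral_const_mul, integral_const_mul, hν.2]

end HaarMoments

/-! ### The Pauli bases of one and two qubits -/

section PauliInstances

/-- Commutation signs of the single-qubit Pauli matrices. -/
def pauliSign (p q : Fin 4) : ℤ := if p = 0 ∨ q = 0 ∨ p = q then 1 else -1

theorem isPauliBasis_pauli : IsPauliBasis pauli pauliSign where
  zero := rfl
  herm i := by
    fin_cases i <;> ext x y <;> fin_cases x <;> fin_cases y <;> simp [pauli]
  sq i := by
    fin_cases i <;> ext x y <;> fin_cases x <;> fin_cases y <;> simp [pauli, Matrix.mul_apply]
  comm i j := by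
    fin_cases i <;> fin_cases j <;> ext x y <;> fin_cases x <;> fin_cases y <;>
      simp [pauli, pauliSign, Matrix.mul_apply]
  sign i j := by unfold pauliSign; split_ifs <;> simp
  separates := by decide
  connects := by decide
  complete x y z w := by
    fin_cases x <;> fin_cases y <;> fin_cases z <;> fin_cases w <;>
      simp [pauli, Fin.sum_univ_four] <;> norm_num

/-- The two-qubit Pauli basis. -/
def pauliPair (p : Fin 4 × Fin 4) : Matrix (Fin 2 × Fin 2) (Fin 2 × Fin 2) ℂ :=
  pauli p.1 ⊗ₖ pauli p.2

theorem isPauliBasis_pauliPair :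
    IsPauliBasis pauliPair fun p q => pauliSign p.1 q.1 * pauliSign p.2 q.2 where
  zero := by
    simp only [pauliPair, Prod.fst_zero, Prod.snd_zero, isPauliBasis_pauli.zero, one_kronecker_one]
  herm i := by simp only [pauliPair, conjTranspose_kronecker, isPauliBasis_pauli.herm]
  sq i := by
    simp only [pauliPair, ← mul_kronecker_mul, isPauliBasis_pauli.sq, one_kronecker_one]
  comm i j := by
    simp only [pauliPair, ← mul_kronecker_mul]
    rw [isPauliBasis_pauli.comm i.1, isPauliBasis_pauli.comm i.2]
    simp only [← Int.cast_smul_eq_zsmul ℂ, smul_kronecker, kronecker_smul, smul_smul]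
    push_cast
    rw [mul_comm]
  sign i j := by
    rcases isPauliBasis_pauli.sign i.1 j.1 with h | h <;>
      rcases isPauliBasis_pauli.sign i.2 j.2 with h' | h' <;> simp [h, h']
  separates := by decide
  connects := by decide
  complete x y z w := by
    simp only [pauliPair, kroneckerMap_apply, Fintype.sum_prod_type]
    have : ∀ p q : Fin 4, pauli p x.1 y.1 * pauli q x.2 y.2 * (pauli p z.1 w.1 * pauli q z.2 w.2)
        = (pauli p x.1 y.1 * pauli p z.1 w.1) * (pauli q x.2 y.2 * pauli q z.2 w.2) := by
      intros; ring
    simp only [this, ← Finset.mul_sum, ← Finset.sum_mul, isPauliBasis_pauli.complete]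
    simp only [Prod.ext_iff, Fintype.card_prod, Fintype.card_fin]
    split_ifs <;> simp_all; norm_num

end PauliInstances

/-! ### Pauli strings, and the action of tensor products, noise and gates on Pauli coefficients -/

section PauliStrings

variable {n : ℕ}

theorem tensor_mul (A B : Fin n → Matrix (Fin 2) (Fin 2) ℂ) :
    tensor A * tensor B = tensor fun i => A i * B i := by
  ext x y
  simp only [tensor, Matrix.mul_apply, Matrix.of_apply]
  rw [Finset.prod_univ_sum, Fintype.piFinset_univ]
  exact Finset.sum_congr rfl fun z _ => Finset.prod_mul_distrib.symm

theorem conjTranspose_tensor (A : Fin n → Matrix (Fin 2) (Fin 2) ℂ) :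
    (tensor A)ᴴ = tensor fun i => (A i)ᴴ := by
  ext x y
  simp [tensor]

theorem tensor_one : tensor (fun _ : Fin n => (1 : Matrix (Fin 2) (Fin 2) ℂ)) = 1 := by
  ext x y
  simp only [tensor, Matrix.of_apply, Matrix.one_apply, Finset.prod_ite_zero]
  simp [funext_iff]

theorem tensor_sum_pauli (c : Fin n → Fin 4 → ℂ) :
    tensor (fun i => ∑ q, c i q • pauli q) =
      ∑ Q : Fin n → Fin 4, (∏ i, c i (Q i)) • pauliString Q := by
  ext x y
  simp only [tensor, pauliString, Matrix.of_apply, Matrix.sum_apply, Matrix.smul_apply, smul_eq_mul]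
  rw [Finset.prod_univ_sum, Fintype.piFinset_univ]
  exact Finset.sum_congr rfl fun z _ => Finset.prod_mul_distrib

theorem conjTranspose_pauliString (P : Fin n → Fin 4) : (pauliString P)ᴴ = pauliString P := by
  simp only [pauliString, conjTranspose_tensor, isPauliBasis_pauli.herm]

theorem pauliString_mul_self (P : Fin n → Fin 4) : pauliString P * pauliString P = 1 := by
  simp only [pauliString, tensor_mul, isPauliBasis_pauli.sq, tensor_one]

theorem pauliString_zero : pauliString (0 : Fin n → Fin 4) = 1 := by
  simp only [pauliString, Pi.zero_apply, isPauliBasis_pauli.zero, tensor_one]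

theorem sum_pauliString_mul (x y z w : Fin n → Fin 2) :
    ∑ P : Fin n → Fin 4, pauliString P x y * pauliString P z w =
      if x = w ∧ y = z then 2 ^ n else 0 := by
  simp only [pauliString, tensor, Matrix.of_apply, ← Finset.prod_mul_distrib]
  have := (Finset.prod_univ_sum (fun _ : Fin n => (Finset.univ : Finset (Fin 4)))
    (fun i p => pauli p (x i) (y i) * pauli p (z i) (w i)))
  rw [Fintype.piFinset_univ] at this
  rw [← this]
  simp only [isPauliBasis_pauli.complete, Fintype.card_fin, Finset.prod_ite_zero]
  simp [funext_iff, forall_and]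

/-- The coefficient `Tr(P A)` of an operator in the Pauli basis. -/
def pauliCoeff (A : Op n) (P : Fin n → Fin 4) : ℂ := (pauliString P * A).trace

theorem pauliCoeff_sub (A B : Op n) (P : Fin n → Fin 4) :
    pauliCoeff (A - B) P = pauliCoeff A P - pauliCoeff B P := by
  simp only [pauliCoeff, mul_sub, trace_sub]

theorem pauliCoeff_zero (A : Op n) : pauliCoeff A 0 = A.trace := by
  rw [pauliCoeff, pauliString_zero, one_mul]

/-- Parseval's identity for the Pauli basis. -/
theorem sum_pauliCoeff_mul_star (A : Op n) :
    ∑ P, pauliCoeff A P * star (pauliCoeff A P) = 2 ^ n * (Aᴴ * A).trace :=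
  sum_trace_mul_star_of_complete conjTranspose_pauliString sum_pauliString_mul A

theorem pauliCoeff_conj_tensor (u : Fin n → Matrix (Fin 2) (Fin 2) ℂ) (B : Op n)
    (P : Fin n → Fin 4) :
    pauliCoeff (tensor u * B * (tensor u)ᴴ) P =
      ∑ Q : Fin n → Fin 4, (∏ i, conjCoeff pauli (u i) (P i) (Q i)) * pauliCoeff B Q := by
  have h : (tensor u)ᴴ * pauliString P * tensor u =
      ∑ Q : Fin n → Fin 4, (∏ i, conjCoeff pauli (u i) (P i) (Q i)) • pauliString Q := by
    rw [pauliString, conjTranspose_tensor, tensor_mul, tensor_mul, ← tensor_sum_pauli]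
    simp only [isPauliBasis_pauli.conj_eq_sum]
  calc _ = ((tensor u)ᴴ * pauliString P * tensor u * B).trace := by
        rw [pauliCoeff, ← mul_assoc, trace_mul_comm]
        simp only [mul_assoc]
    _ = _ := by
        rw [h]
        simp only [Finset.sum_mul, trace_sum, smul_mul_assoc, trace_smul, smul_eq_mul, pauliCoeff]

/-! ### Noise -/

/-- The Pauli transfer matrix of a single-qubit map. -/
def transferMatrix (N : Matrix (Fin 2) (Fin 2) ℂ →ₗ[ℂ] Matrix (Fin 2) (Fin 2) ℂ)
    (p q : Fin 4) : ℂ := (pauli p * N (pauli q)).trace / 2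

/-- The tensor power is defined through matrix units; expanding a matrix unit in the Pauli basis
converts it to the transfer matrix. -/
theorem trace_pauli_mul_map_single
    (N : Matrix (Fin 2) (Fin 2) ℂ →ₗ[ℂ] Matrix (Fin 2) (Fin 2) ℂ) (p : Fin 4) (x y : Fin 2) :
    (pauli p * N (Matrix.single x y 1)).trace = ∑ q, transferMatrix N p q * pauli q y x := by
  have h := isPauliBasis_pauli.sum_trace_smul (Matrix.single x y (1 : ℂ))
  have h1 : ∀ q, (pauli q * Matrix.single x y (1 : ℂ)).trace = pauli q y x := by
    intro q
    rw [Matrix.trace_mul_single, MulOpposite.op_one, one_smul]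
  simp only [h1, Fintype.card_fin] at h
  have h2 := congrArg (fun A => (pauli p * N A).trace / 2) h
  simp only [map_sum, map_smul, Finset.mul_sum, trace_sum, mul_smul_comm, trace_smul, smul_eq_mul,
    Finset.sum_div, Nat.cast_ofNat] at h2
  rw [mul_div_cancel_left₀ _ two_ne_zero] at h2
  rw [← h2]
  exact Finset.sum_congr rfl fun q _ => by rw [transferMatrix]; ring

theorem pauliCoeff_tensorPower
    (N : Matrix (Fin 2) (Fin 2) ℂ →ₗ[ℂ] Matrix (Fin 2) (Fin 2) ℂ) (A : Op n) (P : Fin n → Fin 4) :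
    pauliCoeff (tensorPower N A) P =
      ∑ Q : Fin n → Fin 4, (∏ i, transferMatrix N (P i) (Q i)) * pauliCoeff A Q := by
  have htr : ∀ B : Fin n → Matrix (Fin 2) (Fin 2) ℂ, (tensor B).trace = ∏ i, (B i).trace := by
    intro B
    simp only [trace, diag, tensor, Matrix.of_apply]
    rw [Finset.prod_univ_sum, Fintype.piFinset_univ]
  have h : ∀ x y : Fin n → Fin 2,
      (pauliString P * tensor fun i => N (Matrix.single (x i) (y i) 1)).trace =
      ∑ Q : Fin n → Fin 4, (∏ i, transferMatrix N (P i) (Q i)) * pauliString Q y x := by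
    intro x y
    rw [pauliString, tensor_mul, htr]
    simp only [trace_pauli_mul_map_single]
    rw [Finset.prod_univ_sum, Fintype.piFinset_univ]
    exact Finset.sum_congr rfl fun z _ => Finset.prod_mul_distrib
  simp only [pauliCoeff, tensorPower, Finset.mul_sum, trace_sum, mul_smul_comm, trace_smul, h,
    smul_eq_mul]
  simp only [trace, diag, Matrix.mul_apply, Finset.mul_sum]
  rw [Finset.sum_congr rfl fun x _ => Finset.sum_comm, Finset.sum_comm]
  refine Finset.sum_congr rfl fun Q _ => ?_
  rw [Finset.sum_comm]
  exact Finset.sum_congr rfl fun y _ => Finset.sum_congr rfl fun x _ => by ring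

/-! ### Gates -/

/-- Replace the entries of `x` at `a` and `b` by the components of `q`. -/
def setPair {α : Type} (x : Fin n → α) (a b : Fin n) (q : α × α) : Fin n → α :=
  Function.update (Function.update x a q.1) b q.2

variable {α : Type} {a b : Fin n}

theorem setPair_fst (hab : a ≠ b) (x : Fin n → α) (q : α × α) : setPair x a b q a = q.1 := by
  simp [setPair, hab]

theorem setPair_snd (x : Fin n → α) (q : α × α) : setPair x a b q b = q.2 := by
  simp [setPair]

theorem setPair_of_ne (x : Fin n → α) (q : α × α) {k : Fin n} (ha : k ≠ a) (hb : k ≠ b) :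
    setPair x a b q k = x k := by
  simp [setPair, ha, hb]

theorem eq_setPair_iff (hab : a ≠ b) {x z : Fin n → α} {q : α × α} :
    z = setPair x a b q ↔ z a = q.1 ∧ z b = q.2 ∧ ∀ k, k ≠ a → k ≠ b → z k = x k := by
  constructor
  · rintro rfl
    exact ⟨setPair_fst hab x q, setPair_snd x q, fun k ha hb => setPair_of_ne x q ha hb⟩
  · rintro ⟨h1, h2, h3⟩
    ext k
    by_cases ha : k = a
    · rw [ha, setPair_fst hab, h1]
    by_cases hb : k = b
    · rw [hb, setPair_snd, h2]
    rw [setPair_of_ne x q ha hb, h3 k ha hb]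

theorem setPair_self (hab : a ≠ b) (x : Fin n → α) : setPair x a b (x a, x b) = x :=
  ((eq_setPair_iff hab).mpr ⟨rfl, rfl, fun _ _ _ => rfl⟩).symm

theorem conjTranspose_embedGate (a b : Fin n) (G : Matrix (Fin 2 × Fin 2) (Fin 2 × Fin 2) ℂ) :
    (embedGate a b G)ᴴ = embedGate a b Gᴴ := by
  ext x y
  simp only [embedGate, conjTranspose_apply, Matrix.of_apply]
  have : (∀ k, k ≠ a → k ≠ b → y k = x k) ↔ (∀ k, k ≠ a → k ≠ b → x k = y k) := by
    simp only [eq_comm]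
  simp only [this]
  split_ifs <;> simp

/-- The matrix on strings that acts as `C` on the entries `a`, `b` and trivially on the others. -/
def pairMatrix {R : Type} [Zero R] [DecidableEq α] (a b : Fin n) (C : Matrix (α × α) (α × α) R) :
    Matrix (Fin n → α) (Fin n → α) R :=
  Matrix.of fun x y => if ∀ k, k ≠ a → k ≠ b → x k = y k then C (x a, x b) (y a, y b) else 0

/-- A row of such a matrix is supported on the strings that differ from `x` at most at `a` and `b`,
and these are parametrised by the pair of entries there. -/
theorem sum_pairMatrix_mul {R : Type} [CommRing R] [DecidableEq α] [Fintype α] (hab : a ≠ b)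
    (C : Matrix (α × α) (α × α) R) (x : Fin n → α) (f : (Fin n → α) → R) :
    ∑ z, pairMatrix a b C x z * f z = ∑ q, C (x a, x b) q * f (setPair x a b q) := by
  symm
  refine Fintype.sum_of_injective (fun q => setPair x a b q) ?_ _ _ ?_ ?_
  · intro q r h
    have h1 := congrFun h a
    have h2 := congrFun h b
    simp only [setPair_fst hab, setPair_snd] at h1 h2
    exact Prod.ext h1 h2
  · intro z hz
    rw [pairMatrix, Matrix.of_apply, if_neg, zero_mul]
    intro h
    exact hz ⟨(z a, z b), ((eq_setPair_iff hab).mpr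
      ⟨rfl, rfl, fun k ha hb => (h k ha hb).symm⟩).symm⟩
  · intro q
    rw [pairMatrix, Matrix.of_apply, if_pos fun k ha hb => (setPair_of_ne x q ha hb).symm,
      setPair_fst hab, setPair_snd]

theorem embedGate_mul_apply (hab : a ≠ b) (G : Matrix (Fin 2 × Fin 2) (Fin 2 × Fin 2) ℂ) (M : Op n)
    (x y : Fin n → Fin 2) :
    (embedGate a b G * M) x y = ∑ q, G (x a, x b) q * M (setPair x a b q) y :=
  (Matrix.mul_apply).trans (sum_pairMatrix_mul hab G x fun z => M z y)

/-- The operator that acts as `X` on the qubits `a`, `b` and as the Pauli string `P` on the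
others. -/
def embedInString (P : Fin n → Fin 4) (a b : Fin n)
    (X : Matrix (Fin 2 × Fin 2) (Fin 2 × Fin 2) ℂ) : Op n :=
  Matrix.of fun x y => X (x a, x b) (y a, y b) *
    ∏ k ∈ (Finset.univ.erase a).erase b, pauli (P k) (x k) (y k)

theorem pauliString_setPair (hab : a ≠ b) (P : Fin n → Fin 4) (q : Fin 4 × Fin 4) :
    pauliString (setPair P a b q) = embedInString P a b (pauliPair q) := by
  ext x y
  simp only [pauliString, tensor, embedInString, Matrix.of_apply, pauliPair, kroneckerMap_apply]
  rw [← Finset.mul_prod_erase _ _ (Finset.mem_univ a),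
    ← Finset.mul_prod_erase _ _ (Finset.mem_erase.mpr ⟨hab.symm, Finset.mem_univ b⟩),
    setPair_fst hab, setPair_snd, mul_assoc]
  congr 2
  refine Finset.prod_congr rfl fun k hk => ?_
  rw [setPair_of_ne P q (Finset.ne_of_mem_erase (Finset.mem_of_mem_erase hk))
    (Finset.ne_of_mem_erase hk)]

theorem conjTranspose_embedInString (P : Fin n → Fin 4) (a b : Fin n)
    (X : Matrix (Fin 2 × Fin 2) (Fin 2 × Fin 2) ℂ) :
    (embedInString P a b X)ᴴ = embedInString P a b Xᴴ := by
  ext x y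
  simp only [embedInString, conjTranspose_apply, Matrix.of_apply, star_mul', star_prod]
  congr 1
  refine Finset.prod_congr rfl fun k _ => ?_
  rw [← conjTranspose_apply, isPauliBasis_pauli.herm]

theorem embedGate_mul_embedInString (hab : a ≠ b) (P : Fin n → Fin 4)
    (G X : Matrix (Fin 2 × Fin 2) (Fin 2 × Fin 2) ℂ) :
    embedGate a b G * embedInString P a b X = embedInString P a b (G * X) := by
  ext x y
  rw [embedGate_mul_apply hab]
  simp only [embedInString, Matrix.of_apply, Matrix.mul_apply, Finset.sum_mul, setPair_fst hab,
    setPair_snd]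
  refine Finset.sum_congr rfl fun q _ => ?_
  rw [← mul_assoc]
  congr 1
  refine Finset.prod_congr rfl fun k hk => ?_
  rw [setPair_of_ne x q (Finset.ne_of_mem_erase (Finset.mem_of_mem_erase hk))
    (Finset.ne_of_mem_erase hk)]

/-- The matrix of the conjugation by a two-qubit gate in the two-qubit Pauli basis. -/
def gateTransfer (G : Matrix (Fin 2 × Fin 2) (Fin 2 × Fin 2) ℂ) :
    Matrix (Fin 4 × Fin 4) (Fin 4 × Fin 4) ℂ :=
  Matrix.of fun p q => conjCoeff pauliPair G p q

theorem pauliCoeff_conj_embedGate (hab : a ≠ b) (G : Matrix (Fin 2 × Fin 2) (Fin 2 × Fin 2) ℂ)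
    (B : Op n) (P : Fin n → Fin 4) :
    pauliCoeff (embedGate a b G * B * (embedGate a b G)ᴴ) P =
      (pairMatrix a b (gateTransfer G) *ᵥ pauliCoeff B) P := by
  rw [mulVec, dotProduct, sum_pairMatrix_mul hab]
  simp only [gateTransfer, Matrix.of_apply]
  have h : (embedGate a b G)ᴴ * pauliString P * embedGate a b G =
      ∑ q, conjCoeff pauliPair G (P a, P b) q • pauliString (setPair P a b q) := by
    have h1 : (embedGate a b G)ᴴ * pauliString P * embedGate a b G =
        embedInString P a b (Gᴴ * pauliPair (P a, P b) * G) := by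
      conv_lhs => rw [← setPair_self hab P, pauliString_setPair hab]
      rw [conjTranspose_embedGate, embedGate_mul_embedInString hab]
      -- Passing to adjoints turns the remaining multiplication on the right into one on the left.
      apply conjTranspose_injective
      rw [conjTranspose_mul, conjTranspose_embedGate, conjTranspose_embedInString,
        conjTranspose_embedInString, embedGate_mul_embedInString hab, ← conjTranspose_mul]
    rw [h1, isPauliBasis_pauliPair.conj_eq_sum]
    simp only [pauliString_setPair hab]
    ext x y
    simp only [embedInString, Matrix.of_apply, Matrix.sum_apply, Matrix.smul_apply, Finset.sum_mul,
      smul_eq_mul, mul_assoc]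
  calc _ = ((embedGate a b G)ᴴ * pauliString P * embedGate a b G * B).trace := by
        rw [pauliCoeff, ← mul_assoc, trace_mul_comm]
        simp only [mul_assoc]
    _ = _ := by
        rw [h]
        simp only [Finset.sum_mul, trace_sum, smul_mul_assoc, trace_smul, smul_eq_mul, pauliCoeff]

end PauliStrings

/-! ### Second moments of products of independent random matrices -/

section SecondMoment

variable {ι Ω Ω' : Type} [Fintype ι] [MeasurableSpace Ω] [MeasurableSpace Ω']

/-- The map `A ↦ 𝔼 [R A R†]` for a random matrix `R`. -/
def secondMoment (μ : Measure Ω) (R : Ω → Matrix ι ι ℂ) (A : Matrix ι ι ℂ) : Matrix ι ι ℂ :=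
  Matrix.of fun P P' => ∫ ω, (R ω * A * (R ω)ᴴ) P P' ∂μ

theorem mul_mul_conjTranspose_apply (R A : Matrix ι ι ℂ) (P P' : ι) :
    (R * A * Rᴴ) P P' = ∑ Q, ∑ Q', R P Q * star (R P' Q') * A Q Q' := by
  simp only [Matrix.mul_apply, conjTranspose_apply, Finset.sum_mul]
  rw [Finset.sum_comm]
  exact Finset.sum_congr rfl fun Q _ => Finset.sum_congr rfl fun Q' _ => by ring

variable [TopologicalSpace Ω] [CompactSpace Ω] [OpensMeasurableSpace Ω]
  [TopologicalSpace Ω'] [CompactSpace Ω'] [OpensMeasurableSpace Ω']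

theorem integrable_mul_star {μ : Measure Ω} [IsFiniteMeasure μ] {R : Ω → Matrix ι ι ℂ}
    (hR : Continuous R) (P Q P' Q' : ι) : Integrable (fun ω => R ω P Q * star (R ω P' Q')) μ :=
  integrable_of_continuous ((hR.matrix_elem P Q).mul (hR.matrix_elem P' Q').star)

theorem secondMoment_apply {μ : Measure Ω} [IsFiniteMeasure μ] {R : Ω → Matrix ι ι ℂ}
    (hR : Continuous R) (A : Matrix ι ι ℂ) (P P' : ι) :
    secondMoment μ R A P P' =
      ∑ Q, ∑ Q', (∫ ω, R ω P Q * star (R ω P' Q') ∂μ) * A Q Q' := by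
  simp only [secondMoment, Matrix.of_apply, mul_mul_conjTranspose_apply]
  have hi : ∀ Q Q', Integrable (fun ω => R ω P Q * star (R ω P' Q') * A Q Q') μ := fun Q Q' =>
    (integrable_mul_star hR P Q P' Q').mul_const _
  rw [integral_finsetSum _ fun Q _ => integrable_finsetSum _ fun Q' _ => hi Q Q']
  refine Finset.sum_congr rfl fun Q _ => ?_
  rw [integral_finsetSum _ fun Q' _ => hi Q Q']
  exact Finset.sum_congr rfl fun Q' _ => integral_mul_const _ _

/-- Independence lets the inner factor be averaged first. Two orders are needed: inside a layer the
first gate is the outermost factor, whereas the first layer of the circuit is the innermost one and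
calls for the swapped version. -/
theorem secondMoment_prod {μ : Measure Ω} {ν : Measure Ω'} [IsFiniteMeasure μ] [IsFiniteMeasure ν]
    {X : Ω → Matrix ι ι ℂ} {Y : Ω' → Matrix ι ι ℂ} (hX : Continuous X) (hY : Continuous Y)
    (A : Matrix ι ι ℂ) :
    secondMoment (μ.prod ν) (fun z => X z.1 * Y z.2) A =
      secondMoment μ X (secondMoment ν Y A) := by
  ext P P'
  rw [secondMoment_apply hX]
  have hYi : ∀ Q Q', Integrable (fun ω => (Y ω * A * (Y ω)ᴴ) Q Q') ν := fun Q Q' =>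
    integrable_of_continuous
      (((hY.matrix_mul continuous_const).matrix_mul hY.matrix_conjTranspose).matrix_elem Q Q')
  have e : ∀ z : Ω × Ω', (X z.1 * Y z.2 * A * (X z.1 * Y z.2)ᴴ) P P' =
      ∑ Q, ∑ Q', X z.1 P Q * star (X z.1 P' Q') * (Y z.2 * A * (Y z.2)ᴴ) Q Q' := by
    intro z
    rw [← mul_mul_conjTranspose_apply, conjTranspose_mul]
    simp only [Matrix.mul_assoc]
  simp only [secondMoment, Matrix.of_apply, e]
  have hi : ∀ Q Q', Integrable (fun z : Ω × Ω' =>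
      X z.1 P Q * star (X z.1 P' Q') * (Y z.2 * A * (Y z.2)ᴴ) Q Q') (μ.prod ν) := fun Q Q' =>
    (integrable_mul_star hX P Q P' Q').mul_prod (hYi Q Q')
  rw [integral_finsetSum _ fun Q _ => integrable_finsetSum _ fun Q' _ => hi Q Q']
  refine Finset.sum_congr rfl fun Q _ => ?_
  rw [integral_finsetSum _ fun Q' _ => hi Q Q']
  exact Finset.sum_congr rfl fun Q' _ => integral_prod_mul (fun x => X x P Q * star (X x P' Q'))
    fun y => (Y y * A * (Y y)ᴴ) Q Q'

theorem secondMoment_prod_swap {μ : Measure Ω} {ν : Measure Ω'} [IsFiniteMeasure μ]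
    [IsFiniteMeasure ν] {X : Ω → Matrix ι ι ℂ} {Y : Ω' → Matrix ι ι ℂ} (hX : Continuous X)
    (hY : Continuous Y) (A : Matrix ι ι ℂ) :
    secondMoment (μ.prod ν) (fun z => Y z.2 * X z.1) A =
      secondMoment ν Y (secondMoment μ X A) := by
  rw [← secondMoment_prod hY hX]
  ext P P'
  simp only [secondMoment, Matrix.of_apply]
  exact integral_prod_swap (μ := ν) (ν := μ)
    (fun z => (Y z.1 * X z.2 * A * (Y z.1 * X z.2)ᴴ) P P')

theorem secondMoment_pi_succ {k : ℕ} {α : Fin (k + 1) → Type} [∀ i, MeasurableSpace (α i)]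
    (μ : ∀ i, Measure (α i)) [∀ i, SigmaFinite (μ i)]
    (R : (∀ i, α i) → Matrix ι ι ℂ) (A : Matrix ι ι ℂ) :
    secondMoment (Measure.pi μ) R A =
      secondMoment ((μ 0).prod (Measure.pi fun j : Fin k => μ j.succ))
        (fun z => R (Fin.cons z.1 z.2)) A := by
  ext P P'
  simp only [secondMoment, Matrix.of_apply]
  have e : ∀ z : α 0 × (∀ j : Fin k, α j.succ),
      (MeasurableEquiv.piFinSuccAbove α 0).symm z = Fin.cons z.1 z.2 := by
    intro z
    exact (MeasurableEquiv.piFinSuccAbove α 0).injective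
      (MeasurableEquiv.apply_symm_apply (MeasurableEquiv.piFinSuccAbove α 0) z)
  have h := (measurePreserving_piFinSuccAbove μ 0).symm.integral_comp'
    (fun g => (R g * A * (R g)ᴴ) P P')
  rw [← h]
  exact integral_congr_ae (Filter.Eventually.of_forall fun z =>
    congrArg (fun g => (R g * A * (R g)ᴴ) P P') (e z))

end SecondMoment

/-! ### The uniform kernel as a stochastic matrix -/

section Kernel

variable {ι : Type} [Fintype ι] [DecidableEq ι] [Zero ι]

theorem uniformKernel_zero_left (q : ι) :
    uniformKernel 0 q = if q = 0 then 1 else 0 := by simp [uniformKernel]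

theorem uniformKernel_comm (p q : ι) : uniformKernel p q = uniformKernel q p := by
  unfold uniformKernel; split_ifs <;> rfl

theorem uniformKernel_nonneg (p q : ι) : 0 ≤ uniformKernel p q := by
  have : (1 : ℝ) ≤ Fintype.card ι := by exact_mod_cast Fintype.card_pos_iff.mpr ⟨(0 : ι)⟩
  unfold uniformKernel
  split_ifs
  · exact zero_le_one
  · exact le_rfl
  · exact le_rfl
  · exact div_nonneg zero_le_one (by linarith)

theorem eq_zero_iff_of_uniformKernel_ne_zero {p q : ι} (h : uniformKernel p q ≠ 0) :
    p = 0 ↔ q = 0 := by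
  unfold uniformKernel at h
  split_ifs at h <;> simp_all

theorem uniformKernel_congr_left {p p' : ι} (h : p = 0 ↔ p' = 0) (q : ι) :
    uniformKernel p q = uniformKernel p' q := by
  simp only [uniformKernel, h]

theorem sum_uniformKernel_mul {f : ι → ℝ} (p : ι) :
    ∑ q, uniformKernel p q * f q =
      if p = 0 then f 0 else (∑ q, f q - f 0) / ((Fintype.card ι : ℝ) - 1) := by
  split_ifs with hp
  · simp [hp, uniformKernel_zero_left]
  · rw [← Finset.add_sum_erase _ _ (Finset.mem_univ 0), ← Finset.add_sum_erase _ f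
      (Finset.mem_univ 0), add_sub_cancel_left, Finset.sum_div, uniformKernel, if_neg hp,
      if_pos rfl, zero_mul, zero_add]
    refine Finset.sum_congr rfl fun q hq => ?_
    rw [uniformKernel, if_neg hp, if_neg (Finset.ne_of_mem_erase hq), one_div_mul_eq_div]

theorem sum_uniformKernel (p : ι) : ∑ q, uniformKernel p q = 1 := by
  have h := sum_uniformKernel_mul (f := fun _ => 1) p
  simp only [mul_one] at h
  rw [h]
  split_ifs with hp
  · rfl
  · have : (1 : ℝ) < Fintype.card ι := by
      exact_mod_cast Fintype.one_lt_card_iff.mpr ⟨p, 0, hp⟩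
    simp only [Finset.sum_const, Finset.card_univ, nsmul_eq_mul, mul_one]
    exact div_self (by linarith)

/-- The uniform kernel absorbs any kernel that fixes `0` and preserves the uniform measure. -/
theorem sum_uniformKernel_mul_kernel {k : ι → ι → ℝ} (hk0 : ∀ z, k 0 z = if z = 0 then 1 else 0)
    (hk : ∀ z, ∑ q, k q z = 1) (p z : ι) :
    ∑ q, uniformKernel p q * k q z = uniformKernel p z := by
  rw [sum_uniformKernel_mul, uniformKernel, hk, hk0]
  split_ifs <;> simp

end Kernel

/-! ### Averaged gates and noise acting on second moments -/

section Arrays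

variable {n : ℕ} {a b : Fin n}

/-- The transition matrix of the simultaneous single-qubit twirl on Pauli strings. -/
def twirlKernel (n : ℕ) : Matrix (Fin n → Fin 4) (Fin n → Fin 4) ℝ :=
  Matrix.of fun P Q => ∏ i, uniformKernel (P i) (Q i)

/-- The real parts of the diagonal entries. -/
def diagRe {ι : Type} (A : Matrix ι ι ℂ) (P : ι) : ℝ := (A P P).re

/-- The averages of the diagonal entries over the Pauli strings with a given support. -/
def twirl (A : Matrix (Fin n → Fin 4) (Fin n → Fin 4) ℂ) : (Fin n → Fin 4) → ℝ :=
  twirlKernel n *ᵥ diagRe A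

theorem twirlKernel_nonneg (P Q : Fin n → Fin 4) : 0 ≤ twirlKernel n P Q := by
  rw [twirlKernel, Matrix.of_apply]
  exact Finset.prod_nonneg fun _ _ => uniformKernel_nonneg _ _

theorem sum_twirlKernel (P : Fin n → Fin 4) : ∑ Q, twirlKernel n P Q = 1 := by
  simp only [twirlKernel, Matrix.of_apply]
  have h := Finset.prod_univ_sum (fun _ : Fin n => (Finset.univ : Finset (Fin 4)))
    fun i q => uniformKernel (P i) q
  rw [Fintype.piFinset_univ] at h
  rw [← h]
  simp only [sum_uniformKernel, Finset.prod_const_one]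

theorem twirlKernel_transpose : (twirlKernel n)ᵀ = twirlKernel n := by
  ext P Q
  simp only [twirlKernel, transpose_apply, Matrix.of_apply, uniformKernel_comm]

/-- The transition matrix of a two-qubit gate drawn from a 2-design on Pauli strings. -/
def gateKernel (a b : Fin n) : Matrix (Fin n → Fin 4) (Fin n → Fin 4) ℝ :=
  pairMatrix a b (Matrix.of uniformKernel)

theorem gateKernel_mulVec (hab : a ≠ b) (x : (Fin n → Fin 4) → ℝ) (P : Fin n → Fin 4) :
    (gateKernel a b *ᵥ x) P = ∑ q, uniformKernel (P a, P b) q * x (setPair P a b q) := by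
  rw [mulVec, dotProduct, gateKernel, sum_pairMatrix_mul hab]
  rfl

theorem gateKernel_transpose : (gateKernel a b)ᵀ = gateKernel a b := by
  ext P Q
  simp only [gateKernel, pairMatrix, transpose_apply, Matrix.of_apply]
  have : (∀ k, k ≠ a → k ≠ b → Q k = P k) ↔ (∀ k, k ≠ a → k ≠ b → P k = Q k) := by
    simp only [eq_comm]
  simp only [this, uniformKernel_comm (Q a, Q b)]

/-- The two single-qubit twirls on `a` and `b` fix the identity pair and preserve the uniform
distribution, so the two-qubit kernel absorbs them. The resulting closed form is symmetric in `P`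
and `Z`. -/
theorem gateKernel_mul_twirlKernel_apply (hab : a ≠ b) (P Z : Fin n → Fin 4) :
    (gateKernel a b * twirlKernel n) P Z = uniformKernel (P a, P b) (Z a, Z b) *
      ∏ k ∈ (Finset.univ.erase a).erase b, uniformKernel (P k) (Z k) := by
  have h1 : (gateKernel a b * twirlKernel n) P Z =
      ∑ q, uniformKernel (P a, P b) q * twirlKernel n (setPair P a b q) Z :=
    gateKernel_mulVec hab (fun Q => twirlKernel n Q Z) P
  have h2 : ∀ q, twirlKernel n (setPair P a b q) Z =
      (uniformKernel q.1 (Z a) * uniformKernel q.2 (Z b)) *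
        ∏ k ∈ (Finset.univ.erase a).erase b, uniformKernel (P k) (Z k) := by
    intro q
    rw [twirlKernel, Matrix.of_apply, ← Finset.mul_prod_erase _ _ (Finset.mem_univ a),
      ← Finset.mul_prod_erase _ _ (Finset.mem_erase.mpr ⟨hab.symm, Finset.mem_univ b⟩),
      setPair_fst hab, setPair_snd, mul_assoc]
    congr 2
    refine Finset.prod_congr rfl fun k hk => ?_
    rw [setPair_of_ne P q (Finset.ne_of_mem_erase (Finset.mem_of_mem_erase hk))
      (Finset.ne_of_mem_erase hk)]
  simp only [h1, h2, ← mul_assoc, ← Finset.sum_mul]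
  congr 1
  have h3 := sum_uniformKernel_mul_kernel
    (k := fun q z : Fin 4 × Fin 4 => uniformKernel q.1 z.1 * uniformKernel q.2 z.2)
    (fun z => by
      simp only [Prod.fst_zero, Prod.snd_zero, uniformKernel_zero_left, Prod.ext_iff]
      split_ifs <;> simp_all)
    (fun z => by
      rw [Fintype.sum_prod_type]
      simp only [← Finset.mul_sum, uniformKernel_comm _ z.1, uniformKernel_comm _ z.2,
        sum_uniformKernel, mul_one]) (P a, P b) (Z a, Z b)
  rw [← h3]
  exact Finset.sum_congr rfl fun q _ => by rw [mul_assoc]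

/-- Both factors are symmetric and so is their product, hence they commute. This is what carries a
bound on twirled entries through a gate. -/
theorem twirlKernel_mul_gateKernel (hab : a ≠ b) :
    twirlKernel n * gateKernel a b = gateKernel a b * twirlKernel n := by
  rw [← transpose_transpose (twirlKernel n * gateKernel a b), transpose_mul,
    twirlKernel_transpose, gateKernel_transpose]
  ext P Z
  rw [transpose_apply, gateKernel_mul_twirlKernel_apply hab, gateKernel_mul_twirlKernel_apply hab,
    uniformKernel_comm]
  congr 1
  exact Finset.prod_congr rfl fun k _ => uniformKernel_comm _ _

/-- The action of a two-qubit gate drawn from a 2-design on second moments. -/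
theorem secondMoment_gate {ν : Measure (unitaryGroup (Fin 2 × Fin 2) ℂ)} (hν : IsTwoDesign ν)
    (hab : a ≠ b) (A : Matrix (Fin n → Fin 4) (Fin n → Fin 4) ℂ) (P P' : Fin n → Fin 4) :
    secondMoment ν (fun G => pairMatrix a b (gateTransfer (G : Matrix _ _ ℂ))) A P P' =
      if (P a, P b) = (P' a, P' b) then
        ∑ q, (uniformKernel (P a, P b) q : ℂ) * A (setPair P a b q) (setPair P' a b q)
      else 0 := by
  have hp := hν.1
  have e : ∀ G : unitaryGroup (Fin 2 × Fin 2) ℂ,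
      (pairMatrix a b (gateTransfer (G : Matrix _ _ ℂ)) * A *
        (pairMatrix a b (gateTransfer (G : Matrix _ _ ℂ)))ᴴ) P P' =
      ∑ q, ∑ q', conjCoeff pauliPair G (P a, P b) q * star (conjCoeff pauliPair G (P' a, P' b) q') *
        A (setPair P a b q) (setPair P' a b q') := by
    intro G
    rw [mul_mul_conjTranspose_apply]
    have h1 : ∀ Q, ∑ Q', pairMatrix a b (gateTransfer (G : Matrix _ _ ℂ)) P Q *
          star (pairMatrix a b (gateTransfer (G : Matrix _ _ ℂ)) P' Q') * A Q Q' =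
        pairMatrix a b (gateTransfer (G : Matrix _ _ ℂ)) P Q *
          ∑ q', star (conjCoeff pauliPair G (P' a, P' b) q') * A Q (setPair P' a b q') := by
      intro Q
      have h2 := congrArg star (sum_pairMatrix_mul hab (gateTransfer (G : Matrix _ _ ℂ)) P'
        (fun Q' => star (A Q Q')))
      simp only [star_sum, star_mul', star_star] at h2
      simp only [mul_assoc, ← Finset.mul_sum]
      rw [h2]
      rfl
    simp only [h1]
    rw [sum_pairMatrix_mul hab]
    simp only [Finset.mul_sum, mul_assoc]
    rfl
  have hi : ∀ q q', Integrable (fun G : unitaryGroup (Fin 2 × Fin 2) ℂ =>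
      conjCoeff pauliPair G (P a, P b) q * star (conjCoeff pauliPair G (P' a, P' b) q') *
        A (setPair P a b q) (setPair P' a b q')) ν := fun q q' =>
    integrable_of_continuous (((continuous_conjCoeff _ _).mul (continuous_conjCoeff _ _).star).mul
      continuous_const)
  simp only [secondMoment, Matrix.of_apply, e]
  rw [integral_finsetSum _ fun q _ => integrable_finsetSum _ fun q' _ => hi q q']
  have h3 : ∀ q, ∫ G : unitaryGroup (Fin 2 × Fin 2) ℂ, ∑ q', conjCoeff pauliPair G (P a, P b) q *
        star (conjCoeff pauliPair G (P' a, P' b) q') *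
        A (setPair P a b q) (setPair P' a b q') ∂ν =
      if (P a, P b) = (P' a, P' b) then
        (uniformKernel (P a, P b) q : ℂ) * A (setPair P a b q) (setPair P' a b q) else 0 := by
    intro q
    rw [integral_finsetSum _ fun q' _ => hi q q']
    simp only [integral_mul_const, hν.moment isPauliBasis_pauliPair]
    split_ifs with h
    · simp [h]
    · simp [h]
  simp only [h3]
  split_ifs with h
  · rfl
  · simp

/-- The second moments are unaffected by the single-qubit twirls of the qubits in `S`. -/
structure IsUniformOn (S : Set (Fin n)) (A : Matrix (Fin n → Fin 4) (Fin n → Fin 4) ℂ) : Prop where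
  offDiag : ∀ P P', (∃ i ∈ S, P i ≠ P' i) → A P P' = 0
  diag : ∀ P Q, (∀ i, i ∉ S → P i = Q i) → (∀ i, P i = 0 ↔ Q i = 0) → A P P = A Q Q

/-- The average second moment is at most `K` on every support, and the trace vanishes. -/
structure IsBoundedBy (K : ℝ) (A : Matrix (Fin n → Fin 4) (Fin n → Fin 4) ℂ) : Prop where
  zero : diagRe A 0 ≤ 0
  le : ∀ P, twirl A P ≤ K

theorem diagRe_secondMoment_gate {ν : Measure (unitaryGroup (Fin 2 × Fin 2) ℂ)}
    (hν : IsTwoDesign ν) (hab : a ≠ b) (A : Matrix (Fin n → Fin 4) (Fin n → Fin 4) ℂ) :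
    diagRe (secondMoment ν (fun G => pairMatrix a b (gateTransfer (G : Matrix _ _ ℂ))) A) =
      gateKernel a b *ᵥ diagRe A := by
  ext P
  rw [gateKernel_mulVec hab, diagRe, secondMoment_gate hν hab, if_pos rfl, Complex.re_sum]
  simp only [Complex.re_ofReal_mul, diagRe]

/-- The averaged gate remembers only whether the pair at `a`, `b` is trivial, so both qubits become
twirled. Otherwise it replaces this pair in both strings by the same `q`, which preserves what is
known on `S`. -/
theorem IsUniformOn.secondMoment_gate {S : Set (Fin n)}
    {A : Matrix (Fin n → Fin 4) (Fin n → Fin 4) ℂ} (hA : IsUniformOn S A)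
    {ν : Measure (unitaryGroup (Fin 2 × Fin 2) ℂ)} (hν : IsTwoDesign ν) (hab : a ≠ b) :
    IsUniformOn (insert a (insert b S))
      (secondMoment ν (fun G => pairMatrix a b (gateTransfer (G : Matrix _ _ ℂ))) A) where
  offDiag P P' := by
    rintro ⟨i, hi, hne⟩
    rw [NoisyCircuit.secondMoment_gate hν hab]
    split_ifs with h
    swap
    · rfl
    obtain ⟨h1, h2⟩ := Prod.mk.inj h
    refine Finset.sum_eq_zero fun q _ => ?_
    have hia : i ≠ a := by rintro rfl; exact hne h1
    have hib : i ≠ b := by rintro rfl; exact hne h2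
    rw [hA.offDiag _ _ ⟨i, (hi.resolve_left hia).resolve_left hib, ?_⟩, mul_zero]
    rwa [setPair_of_ne P q hia hib, setPair_of_ne P' q hia hib]
  diag P Q hPQ hsupp := by
    rw [NoisyCircuit.secondMoment_gate hν hab, NoisyCircuit.secondMoment_gate hν hab, if_pos rfl,
      if_pos rfl]
    refine Finset.sum_congr rfl fun q _ => ?_
    rw [uniformKernel_congr_left (p := (P a, P b)) (p' := (Q a, Q b))
      (by simp only [Prod.mk_eq_zero, hsupp]),
      hA.diag (setPair P a b q) (setPair Q a b q)]
    · intro i hi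
      by_cases hia : i = a
      · rw [hia, setPair_fst hab, setPair_fst hab]
      by_cases hib : i = b
      · rw [hib, setPair_snd, setPair_snd]
      rw [setPair_of_ne P q hia hib, setPair_of_ne Q q hia hib]
      exact hPQ i (by simp [hia, hib, hi])
    · intro i
      by_cases hia : i = a
      · rw [hia, setPair_fst hab, setPair_fst hab]
      by_cases hib : i = b
      · rw [hib, setPair_snd, setPair_snd]
      rw [setPair_of_ne P q hia hib, setPair_of_ne Q q hia hib, hsupp]

/-- After commuting the twirl past the gate, the new values are convex combinations of the old ones,
and the identity string is fixed. -/
theorem IsBoundedBy.secondMoment_gate {K : ℝ} {A : Matrix (Fin n → Fin 4) (Fin n → Fin 4) ℂ}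
    (hA : IsBoundedBy K A) {ν : Measure (unitaryGroup (Fin 2 × Fin 2) ℂ)} (hν : IsTwoDesign ν)
    (hab : a ≠ b) :
    IsBoundedBy K
      (secondMoment ν (fun G => pairMatrix a b (gateTransfer (G : Matrix _ _ ℂ))) A) where
  zero := by
    have h0 : setPair (0 : Fin n → Fin 4) a b 0 = 0 := setPair_self hab 0
    rw [diagRe_secondMoment_gate hν hab, gateKernel_mulVec hab, sum_uniformKernel_mul,
      if_pos (show ((0 : Fin n → Fin 4) a, (0 : Fin n → Fin 4) b) = 0 from rfl), h0]
    exact hA.zero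
  le P := by
    rw [twirl, diagRe_secondMoment_gate hν hab, mulVec_mulVec, twirlKernel_mul_gateKernel hab,
      ← mulVec_mulVec, gateKernel_mulVec hab]
    calc _ ≤ ∑ q, uniformKernel (P a, P b) q * K := Finset.sum_le_sum fun q _ =>
          mul_le_mul_of_nonneg_left (hA.le _) (uniformKernel_nonneg _ _)
      _ = K := by rw [← Finset.sum_mul, sum_uniformKernel, one_mul]

/-- The twirl averages over strings of equal support, on which the diagonal is already constant. -/
theorem IsUniformOn.twirl_eq {A : Matrix (Fin n → Fin 4) (Fin n → Fin 4) ℂ}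
    (hA : IsUniformOn Set.univ A) (P : Fin n → Fin 4) : twirl A P = diagRe A P := by
  rw [twirl, mulVec, dotProduct]
  calc _ = ∑ Q, twirlKernel n P Q * diagRe A P := by
        refine Finset.sum_congr rfl fun Q _ => ?_
        by_cases h : twirlKernel n P Q = 0
        · rw [h, zero_mul, zero_mul]
        · rw [twirlKernel, Matrix.of_apply] at h
          rw [diagRe, diagRe, hA.diag P Q (fun i hi => absurd trivial hi) fun i =>
            eq_zero_iff_of_uniformKernel_ne_zero
              (Finset.prod_ne_zero_iff.mp h i (Finset.mem_univ i))]
    _ = _ := by rw [← Finset.sum_mul, sum_twirlKernel, one_mul]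

/-! ### The effect of the noise on second moments -/

/-- The Pauli transfer matrix of `N^{⊗n}`. -/
def noiseMatrix (n : ℕ) (N : Matrix (Fin 2) (Fin 2) ℂ →ₗ[ℂ] Matrix (Fin 2) (Fin 2) ℂ) :
    Matrix (Fin n → Fin 4) (Fin n → Fin 4) ℂ :=
  Matrix.of fun P Q => ∏ i, transferMatrix N (P i) (Q i)

/-- The mean squared length of the images of the Pauli matrices under the adjoint of `N`. -/
def contraction (N : Matrix (Fin 2) (Fin 2) ℂ →ₗ[ℂ] Matrix (Fin 2) (Fin 2) ℂ) : ℝ :=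
  (1 / 3) * ∑ p ∈ Finset.univ.erase 0, ∑ q, ‖transferMatrix N p q‖ ^ 2

theorem contraction_nonneg (N : Matrix (Fin 2) (Fin 2) ℂ →ₗ[ℂ] Matrix (Fin 2) (Fin 2) ℂ) :
    0 ≤ contraction N :=
  mul_nonneg (by norm_num) (Finset.sum_nonneg fun _ _ => Finset.sum_nonneg fun _ _ => sq_nonneg _)

variable {N : Matrix (Fin 2) (Fin 2) ℂ →ₗ[ℂ] Matrix (Fin 2) (Fin 2) ℂ}

/-- Trace preservation says that the adjoint map is unital. -/
theorem transferMatrix_zero_left (hN : ∀ A, (N A).trace = A.trace) (q : Fin 4) :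
    transferMatrix N 0 q = if q = 0 then 1 else 0 := by
  rw [transferMatrix, isPauliBasis_pauli.zero, one_mul, hN, ← one_mul (pauli q),
    ← isPauliBasis_pauli.zero, isPauliBasis_pauli.trace_mul]
  simp only [eq_comm (a := (0 : Fin 4))]
  split_ifs <;> simp

theorem IsUniformOn.diagRe_noise {A : Matrix (Fin n → Fin 4) (Fin n → Fin 4) ℂ}
    (hA : IsUniformOn Set.univ A) (P : Fin n → Fin 4) :
    diagRe (noiseMatrix n N * A * (noiseMatrix n N)ᴴ) P =
      ∑ Q : Fin n → Fin 4, (∏ i, ‖transferMatrix N (P i) (Q i)‖ ^ 2) * diagRe A Q := by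
  rw [diagRe, mul_mul_conjTranspose_apply, Complex.re_sum]
  refine Finset.sum_congr rfl fun Q _ => ?_
  rw [Finset.sum_eq_single Q]
  · have : noiseMatrix n N P Q * star (noiseMatrix n N P Q) =
        ((∏ i, ‖transferMatrix N (P i) (Q i)‖ ^ 2 : ℝ) : ℂ) := by
      rw [noiseMatrix, Matrix.of_apply, Complex.star_def, Complex.mul_conj, Complex.normSq_eq_norm_sq,
        norm_prod, Finset.prod_pow]
    rw [this, Complex.re_ofReal_mul, diagRe]
  · intro Q' _ hne
    obtain ⟨i, hi⟩ := Function.ne_iff.mp hne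
    rw [hA.offDiag Q Q' ⟨i, trivial, hi.symm⟩, mul_zero]
  · simp

/-- The contraction estimate. Uniformity removes the off-diagonal terms and bounds each diagonal
entry, not only the averages, by `K`. The remaining sum is a product over qubits of averaged squared
row lengths of the transfer matrix. -/
theorem IsUniformOn.twirl_noise_le {A : Matrix (Fin n → Fin 4) (Fin n → Fin 4) ℂ}
    (hA : IsUniformOn Set.univ A) (hN : ∀ A, (N A).trace = A.trace) {K : ℝ} (hK : IsBoundedBy K A)
    (P : Fin n → Fin 4) :
    twirl (noiseMatrix n N * A * (noiseMatrix n N)ᴴ) P ≤ K * contraction N ^ pauliWeight P := by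
  have hd : ∀ Q, diagRe A Q ≤ K := fun Q => (hA.twirl_eq Q).symm.trans_le (hK.le Q)
  rw [twirl, mulVec, dotProduct]
  -- At the identity the row is a unit vector; elsewhere the twirl averages over the three other
  -- rows, which is how `contraction` is normalised.
  have hloc : ∀ p : Fin 4, ∑ p', uniformKernel p p' * ∑ q, ‖transferMatrix N p' q‖ ^ 2 =
      if p = 0 then 1 else contraction N := by
    intro p
    rw [sum_uniformKernel_mul]
    have h0 : ∑ q, ‖transferMatrix N 0 q‖ ^ 2 = 1 := by
      simp [transferMatrix_zero_left hN, apply_ite]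
    split_ifs
    · exact h0
    · rw [contraction, ← Finset.add_sum_erase _ _ (Finset.mem_univ 0), add_sub_cancel_left,
        Fintype.card_fin]
      norm_num
      ring
  calc _ ≤ ∑ P', twirlKernel n P P' *
        ∑ Q : Fin n → Fin 4, (∏ i, ‖transferMatrix N (P' i) (Q i)‖ ^ 2) * K := by
        refine Finset.sum_le_sum fun P' _ => ?_
        rw [hA.diagRe_noise]
        exact mul_le_mul_of_nonneg_left (Finset.sum_le_sum fun Q _ =>
          mul_le_mul_of_nonneg_left (hd Q) (Finset.prod_nonneg fun _ _ => sq_nonneg _))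
          (twirlKernel_nonneg _ _)
    _ = K * ∏ i, ∑ p', uniformKernel (P i) p' * ∑ q, ‖transferMatrix N p' q‖ ^ 2 := by
        rw [Finset.prod_univ_sum, Fintype.piFinset_univ, Finset.mul_sum]
        refine Finset.sum_congr rfl fun P' _ => ?_
        rw [← Finset.sum_mul, Finset.prod_mul_distrib, Finset.prod_univ_sum, Fintype.piFinset_univ,
          twirlKernel, Matrix.of_apply]
        ring
    _ = _ := by
        simp only [hloc]
        rw [Finset.prod_ite, Finset.prod_const_one, one_mul, Finset.prod_const, pauliWeight]

/-- A nonzero string gains at least one factor `c`. The zero string gains none, and is instead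
controlled by the sign of its entry, which trace preservation keeps. -/
theorem IsUniformOn.isBoundedBy_noise {A : Matrix (Fin n → Fin 4) (Fin n → Fin 4) ℂ}
    (hA : IsUniformOn Set.univ A) (hN : ∀ A, (N A).trace = A.trace) (hc : contraction N ≤ 1) {K : ℝ}
    (hK0 : 0 ≤ K) (hK : IsBoundedBy K A) :
    IsBoundedBy (K * contraction N) (noiseMatrix n N * A * (noiseMatrix n N)ᴴ) := by
  have h0 : diagRe (noiseMatrix n N * A * (noiseMatrix n N)ᴴ) 0 ≤ 0 := by
    rw [hA.diagRe_noise, Finset.sum_eq_single 0]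
    · simpa [transferMatrix_zero_left hN] using hK.zero
    · intro Q _ hQ
      obtain ⟨i, hi⟩ := Function.ne_iff.mp hQ
      rw [Finset.prod_eq_zero (Finset.mem_univ i), zero_mul]
      rw [Pi.zero_apply, transferMatrix_zero_left hN, if_neg (show ¬Q i = 0 from hi)]
      simp
    · simp
  refine ⟨h0, fun P => ?_⟩
  by_cases hP : P = 0
  · have : twirl (noiseMatrix n N * A * (noiseMatrix n N)ᴴ) P =
        diagRe (noiseMatrix n N * A * (noiseMatrix n N)ᴴ) 0 := by
      rw [hP, twirl, mulVec, dotProduct, Finset.sum_eq_single 0]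
      · simp [twirlKernel, uniformKernel_zero_left]
      · intro Q _ hQ
        obtain ⟨i, hi⟩ := Function.ne_iff.mp hQ
        rw [twirlKernel, Matrix.of_apply, Finset.prod_eq_zero (Finset.mem_univ i), zero_mul]
        rw [Pi.zero_apply, uniformKernel_zero_left, if_neg (show ¬Q i = 0 from hi)]
      · simp
    rw [this]
    exact h0.trans (mul_nonneg hK0 (contraction_nonneg N))
  · refine (hA.twirl_noise_le hN hK P).trans (mul_le_mul_of_nonneg_left ?_ hK0)
    have : 1 ≤ pauliWeight P := by
      obtain ⟨i, hi⟩ := Function.ne_iff.mp hP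
      exact Finset.card_pos.mpr ⟨i, Finset.mem_filter.mpr ⟨Finset.mem_univ i, hi⟩⟩
    exact (pow_le_pow_of_le_one (contraction_nonneg N) hc this).trans_eq (pow_one _)

end Arrays

/-! ### Layers of gates and the whole circuit -/

section Layers

variable {ι Ω : Type} [Fintype ι] [MeasurableSpace Ω] [TopologicalSpace Ω] [CompactSpace Ω]
  [OpensMeasurableSpace Ω]

theorem secondMoment_one [DecidableEq ι] (μ : Measure Ω) [IsProbabilityMeasure μ]
    (A : Matrix ι ι ℂ) : secondMoment μ (fun _ => 1) A = A := by
  ext P P'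
  simp [secondMoment]

theorem secondMoment_const_mul {μ : Measure Ω} [IsFiniteMeasure μ] {R : Ω → Matrix ι ι ℂ}
    (hR : Continuous R) (M A : Matrix ι ι ℂ) :
    secondMoment μ (fun ω => M * R ω) A = M * secondMoment μ R A * Mᴴ := by
  ext P P'
  have hRi : ∀ Q Q', Integrable (fun ω => (R ω * A * (R ω)ᴴ) Q Q') μ := fun Q Q' =>
    integrable_of_continuous
      (((hR.matrix_mul continuous_const).matrix_mul hR.matrix_conjTranspose).matrix_elem Q Q')
  have e : ∀ ω, (M * R ω * A * (M * R ω)ᴴ) P P' =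
      ∑ Q, ∑ Q', M P Q * star (M P' Q') * (R ω * A * (R ω)ᴴ) Q Q' := by
    intro ω
    rw [← mul_mul_conjTranspose_apply, conjTranspose_mul]
    simp only [Matrix.mul_assoc]
  rw [mul_mul_conjTranspose_apply]
  simp only [secondMoment, Matrix.of_apply, e]
  rw [integral_finsetSum _ fun Q _ => integrable_finsetSum _ fun Q' _ => (hRi Q Q').const_mul _]
  refine Finset.sum_congr rfl fun Q _ => ?_
  rw [integral_finsetSum _ fun Q' _ => (hRi Q Q').const_mul _]
  exact Finset.sum_congr rfl fun Q' _ => integral_const_mul _ _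

variable {n : ℕ}

theorem continuous_pairMatrix_gateTransfer (a b : Fin n) :
    Continuous fun G : unitaryGroup (Fin 2 × Fin 2) ℂ =>
      pairMatrix a b (gateTransfer (G : Matrix _ _ ℂ)) := by
  refine continuous_matrix fun P Q => ?_
  simp only [pairMatrix, Matrix.of_apply]
  split_ifs
  · exact continuous_conjCoeff _ _
  · exact continuous_const

/-- The action of a product of gates on Pauli coefficients. -/
def gatesMatrix {k : ℕ} (a b : Fin k → Fin n) (g : Fin k → unitaryGroup (Fin 2 × Fin 2) ℂ) :
    Matrix (Fin n → Fin 4) (Fin n → Fin 4) ℂ :=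
  (List.ofFn fun j => pairMatrix (a j) (b j) (gateTransfer (g j : Matrix _ _ ℂ))).prod

theorem gatesMatrix_succ {k : ℕ} (a b : Fin (k + 1) → Fin n)
    (g : Fin (k + 1) → unitaryGroup (Fin 2 × Fin 2) ℂ) :
    gatesMatrix a b g = pairMatrix (a 0) (b 0) (gateTransfer (g 0 : Matrix _ _ ℂ)) *
      gatesMatrix (fun j => a j.succ) (fun j => b j.succ) fun j => g j.succ := by
  rw [gatesMatrix, List.ofFn_succ, List.prod_cons, gatesMatrix]

theorem continuous_gatesMatrix {k : ℕ} (a b : Fin k → Fin n) : Continuous (gatesMatrix a b) := by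
  induction k with
  | zero => exact continuous_of_const fun _ _ => by simp [gatesMatrix]
  | succ k ih =>
    simp only [funext (gatesMatrix_succ a b)]
    exact ((continuous_pairMatrix_gateTransfer _ _).comp (continuous_apply 0)).matrix_mul
      ((ih _ _).comp (continuous_pi fun j => continuous_apply j.succ))

theorem pauliCoeff_conj_gates {k : ℕ} {a b : Fin k → Fin n} (hab : ∀ j, a j ≠ b j)
    (g : Fin k → unitaryGroup (Fin 2 × Fin 2) ℂ) (B : Op n) :
    pauliCoeff ((List.ofFn fun j => embedGate (a j) (b j) (g j : Matrix _ _ ℂ)).prod * B *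
      ((List.ofFn fun j => embedGate (a j) (b j) (g j : Matrix _ _ ℂ)).prod)ᴴ) =
      gatesMatrix a b g *ᵥ pauliCoeff B := by
  induction k with
  | zero => simp [gatesMatrix]
  | succ k ih =>
    have h := ih (fun j => hab j.succ) (fun j => g j.succ)
    rw [gatesMatrix_succ, ← mulVec_mulVec, ← h, List.ofFn_succ, List.prod_cons]
    ext P
    rw [← pauliCoeff_conj_embedGate (hab 0)]
    simp only [conjTranspose_mul, Matrix.mul_assoc]

/-- Induction on the gates, the head acting last: each gate adds its two qubits to the uniform set,
so a layer that covers all qubits ends with uniformity everywhere, whatever `A` was. -/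
theorem isUniformOn_isBoundedBy_gates {k : ℕ} {a b : Fin k → Fin n} (hab : ∀ j, a j ≠ b j)
    {law : Fin k → Measure (unitaryGroup (Fin 2 × Fin 2) ℂ)} (hlaw : ∀ j, IsTwoDesign (law j))
    {K : ℝ} {A : Matrix (Fin n → Fin 4) (Fin n → Fin 4) ℂ} (hA : IsBoundedBy K A) :
    IsUniformOn {q | ∃ j, a j = q ∨ b j = q}
      (secondMoment (Measure.pi law) (gatesMatrix a b) A) ∧
    IsBoundedBy K (secondMoment (Measure.pi law) (gatesMatrix a b) A) := by
  have hp : ∀ j, IsProbabilityMeasure (law j) := fun j => (hlaw j).1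
  induction k with
  | zero =>
    have e : gatesMatrix a b = fun _ => 1 := by
      ext1 g; simp [gatesMatrix]
    rw [e, secondMoment_one]
    refine ⟨⟨?_, ?_⟩, hA⟩
    · rintro P P' ⟨i, ⟨j, -⟩, -⟩
      exact j.elim0
    · intro P Q h _
      have : P = Q := funext fun i => h i (by rintro ⟨j, -⟩; exact j.elim0)
      rw [this]
  | succ k ih =>
    have e : secondMoment (Measure.pi law) (gatesMatrix a b) A =
        secondMoment (law 0)
          (fun G => pairMatrix (a 0) (b 0) (gateTransfer (G : Matrix _ _ ℂ)))
          (secondMoment (Measure.pi fun j => law j.succ)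
            (gatesMatrix (fun j => a j.succ) fun j => b j.succ) A) := by
      rw [secondMoment_pi_succ, ← secondMoment_prod (continuous_pairMatrix_gateTransfer _ _)
        (continuous_gatesMatrix _ _)]
      simp only [gatesMatrix_succ, Fin.cons_zero, Fin.cons_succ]
    obtain ⟨h1, h2⟩ := ih (fun j => hab j.succ) (fun j => hlaw j.succ) fun j => hp j.succ
    rw [e]
    refine ⟨?_, h2.secondMoment_gate (hlaw 0) (hab 0)⟩
    convert h1.secondMoment_gate (hlaw 0) (hab 0) using 1
    ext q
    simp only [Set.mem_ofPred_eq, Fin.exists_fin_succ, Set.mem_insert_iff, or_assoc, eq_comm]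

/-- The action of a layer of gates on Pauli coefficients. -/
def LayerDistribution.matrix (Λ : LayerDistribution n)
    (g : Fin Λ.numGates → unitaryGroup (Fin 2 × Fin 2) ℂ) :
    Matrix (Fin n → Fin 4) (Fin n → Fin 4) ℂ :=
  gatesMatrix Λ.fst Λ.snd g

theorem LayerDistribution.continuous_matrix (Λ : LayerDistribution n) : Continuous Λ.matrix :=
  continuous_gatesMatrix _ _

instance (Λ : LayerDistribution n) (j : Fin Λ.numGates) : IsProbabilityMeasure (Λ.law j) :=
  (Λ.isTwoDesign j).1

theorem LayerDistribution.isUniformOn_isBoundedBy (Λ : LayerDistribution n) {K : ℝ}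
    {A : Matrix (Fin n → Fin 4) (Fin n → Fin 4) ℂ} (hA : IsBoundedBy K A) :
    IsUniformOn Set.univ (secondMoment (Measure.pi Λ.law) Λ.matrix A) ∧
    IsBoundedBy K (secondMoment (Measure.pi Λ.law) Λ.matrix A) := by
  have h := isUniformOn_isBoundedBy_gates Λ.fst_ne_snd Λ.isTwoDesign hA
  have e : {q | ∃ j, Λ.fst j = q ∨ Λ.snd j = q} = Set.univ := Set.eq_univ_of_forall Λ.covers
  rwa [e] at h

/-! ### The circuit -/

variable (N : Matrix (Fin 2) (Fin 2) ℂ →ₗ[ℂ] Matrix (Fin 2) (Fin 2) ℂ)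

/-- The action of the noisy layers of a circuit on Pauli coefficients. -/
def noisyLayersMatrix {L : ℕ} (Λ : Fin L → LayerDistribution n)
    (g : ∀ l, Fin (Λ l).numGates → unitaryGroup (Fin 2 × Fin 2) ℂ) :
    Matrix (Fin n → Fin 4) (Fin n → Fin 4) ℂ :=
  Fin.foldl L (fun X l => noiseMatrix n N * (Λ l).matrix (g l) * X) 1

/-- Used to split off the first layer as the rightmost factor of the circuit matrix. -/
theorem foldl_mul {R : Type} [Monoid R] {L : ℕ} (S : Fin L → R) (X : R) :
    Fin.foldl L (fun X l => S l * X) X = Fin.foldl L (fun X l => S l * X) 1 * X := by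
  induction L generalizing X with
  | zero => simp
  | succ L ih =>
    rw [Fin.foldl_succ, Fin.foldl_succ, ih (fun l => S l.succ) (S 0 * X),
      ih (fun l => S l.succ) (S 0 * 1), mul_one, mul_assoc]

theorem noisyLayersMatrix_succ {L : ℕ} (Λ : Fin (L + 1) → LayerDistribution n)
    (g : ∀ l, Fin (Λ l).numGates → unitaryGroup (Fin 2 × Fin 2) ℂ) :
    noisyLayersMatrix N Λ g = noisyLayersMatrix N (fun l => Λ l.succ) (fun l => g l.succ) *
      (noiseMatrix n N * (Λ 0).matrix (g 0)) := by
  rw [noisyLayersMatrix, Fin.foldl_succ, foldl_mul, mul_one, noisyLayersMatrix]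

theorem continuous_noisyLayersMatrix {L : ℕ} (Λ : Fin L → LayerDistribution n) :
    Continuous (noisyLayersMatrix N Λ) := by
  induction L with
  | zero => exact continuous_of_const fun _ _ => by simp [noisyLayersMatrix]
  | succ L ih =>
    simp only [funext (noisyLayersMatrix_succ N Λ)]
    exact ((ih fun l => Λ l.succ).comp (continuous_pi fun l => continuous_apply l.succ)).matrix_mul
      (continuous_const.matrix_mul ((LayerDistribution.continuous_matrix _).comp (continuous_apply 0)))

theorem pauliCoeff_noisyLayers {L : ℕ} (Λ : Fin L → LayerDistribution n)
    (g : ∀ l, Fin (Λ l).numGates → unitaryGroup (Fin 2 × Fin 2) ℂ) (A : Op n) :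
    pauliCoeff (Fin.foldl L
      (fun B l => tensorPower N ((Λ l).unitary (g l) * B * ((Λ l).unitary (g l))ᴴ)) A) =
      noisyLayersMatrix N Λ g *ᵥ pauliCoeff A := by
  induction L generalizing A with
  | zero => simp [noisyLayersMatrix]
  | succ L ih =>
    rw [Fin.foldl_succ, ih (fun l => Λ l.succ) (fun l => g l.succ), noisyLayersMatrix_succ,
      ← mulVec_mulVec, ← mulVec_mulVec]
    congr 1
    ext P
    rw [pauliCoeff_tensorPower, LayerDistribution.unitary, pauliCoeff_conj_gates (Λ 0).fst_ne_snd]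
    rfl

variable {N}

/-- Each layer except the last replaces `K` by `K c`, a bound uniform over strings. At the last
layer the finer estimate with the weight of `P` is kept. There are `L + 1` layers, hence the
exponent `L`. -/
theorem twirl_noisyLayers_le (hN : ∀ A, (N A).trace = A.trace) (hc : contraction N ≤ 1) {L : ℕ}
    (Λ : Fin (L + 1) → LayerDistribution n) {K : ℝ} (hK : 0 ≤ K)
    {A : Matrix (Fin n → Fin 4) (Fin n → Fin 4) ℂ} (hA : IsBoundedBy K A) (P : Fin n → Fin 4) :
    twirl (secondMoment (Measure.pi fun l => Measure.pi (Λ l).law) (noisyLayersMatrix N Λ) A) P ≤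
      K * contraction N ^ L * contraction N ^ pauliWeight P := by
  have e : ∀ {L : ℕ} (Λ : Fin (L + 1) → LayerDistribution n)
      (A : Matrix (Fin n → Fin 4) (Fin n → Fin 4) ℂ),
      secondMoment (Measure.pi fun l => Measure.pi (Λ l).law) (noisyLayersMatrix N Λ) A =
      secondMoment (Measure.pi fun l : Fin L => Measure.pi (Λ l.succ).law)
        (noisyLayersMatrix N fun l => Λ l.succ)
        (noiseMatrix n N * secondMoment (Measure.pi (Λ 0).law) (Λ 0).matrix A *
          (noiseMatrix n N)ᴴ) := by
    intro L Λ A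
    rw [secondMoment_pi_succ, ← secondMoment_const_mul (LayerDistribution.continuous_matrix _),
      ← secondMoment_prod_swap (continuous_const.matrix_mul (LayerDistribution.continuous_matrix _))
        (continuous_noisyLayersMatrix N _)]
    simp only [noisyLayersMatrix_succ, Fin.cons_zero, Fin.cons_succ]
  induction L generalizing K A with
  | zero =>
    obtain ⟨h1, h2⟩ := (Λ 0).isUniformOn_isBoundedBy hA
    have e0 : noisyLayersMatrix N (fun l : Fin 0 => Λ l.succ) = fun _ => 1 := by
      ext1 g; simp [noisyLayersMatrix]
    rw [e, e0, secondMoment_one, pow_zero, mul_one]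
    exact h1.twirl_noise_le hN h2 P
  | succ L ih =>
    obtain ⟨h1, h2⟩ := (Λ 0).isUniformOn_isBoundedBy hA
    rw [e, pow_succ', ← mul_assoc]
    exact ih (fun l => Λ l.succ) (mul_nonneg hK (contraction_nonneg N))
      (h1.isBoundedBy_noise hN hc hK h2)

/-- The action of a layer of single-qubit gates on Pauli coefficients. -/
def localMatrix (u : Fin n → unitaryGroup (Fin 2) ℂ) :
    Matrix (Fin n → Fin 4) (Fin n → Fin 4) ℂ :=
  Matrix.of fun P Q => ∏ i, conjCoeff pauli (u i : Matrix (Fin 2) (Fin 2) ℂ) (P i) (Q i)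

theorem continuous_localMatrix : Continuous (localMatrix (n := n)) :=
  continuous_matrix fun P Q => by
    simp only [localMatrix, Matrix.of_apply]
    exact continuous_finsetProd _ fun i _ =>
      (continuous_conjCoeff (P i) (Q i)).comp (continuous_apply i)

/-- By independence the moments of the single-qubit gates factorise, and each factor is a uniform
kernel. Hence control of twirled entries suffices, although the last noise may have spoiled
uniformity. -/
theorem diagRe_secondMoment_local {law : Fin n → Measure (unitaryGroup (Fin 2) ℂ)}
    (hlaw : ∀ i, IsTwoDesign (law i)) (A : Matrix (Fin n → Fin 4) (Fin n → Fin 4) ℂ)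
    (P : Fin n → Fin 4) : diagRe (secondMoment (Measure.pi law) localMatrix A) P = twirl A P := by
  have hp : ∀ i, IsProbabilityMeasure (law i) := fun i => (hlaw i).1
  have hm : ∀ Q Q', ∫ u, localMatrix u P Q * star (localMatrix u P Q') ∂(Measure.pi law) =
      if Q = Q' then (twirlKernel n P Q : ℂ) else 0 := by
    intro Q Q'
    simp only [localMatrix, Matrix.of_apply, star_prod, ← Finset.prod_mul_distrib]
    rw [integral_fintype_prod_eq_prod (fun i (U : unitaryGroup (Fin 2) ℂ) =>
      conjCoeff pauli (U : Matrix (Fin 2) (Fin 2) ℂ) (P i) (Q i) *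
        star (conjCoeff pauli (U : Matrix (Fin 2) (Fin 2) ℂ) (P i) (Q' i)))]
    simp only [(hlaw _).moment isPauliBasis_pauli, true_and, Finset.prod_ite_zero]
    simp [funext_iff, twirlKernel]
  rw [diagRe, secondMoment_apply continuous_localMatrix, Complex.re_sum, twirl, mulVec, dotProduct]
  refine Finset.sum_congr rfl fun Q _ => ?_
  simp only [hm, ite_mul, zero_mul, Finset.sum_ite_eq, Finset.mem_univ, if_true,
    Complex.re_ofReal_mul, diagRe]

variable {L : ℕ} (E : CircuitDistribution n L)

instance (i : Fin n) : IsProbabilityMeasure (E.finalLaw i) := (E.final_isTwoDesign i).1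

instance : IsProbabilityMeasure E.measure := by
  unfold CircuitDistribution.measure
  infer_instance

theorem pauliCoeff_circuit (g : E.Gates) (A : Op n) :
    pauliCoeff (E.circuit N g A) =
      (localMatrix g.2 * noisyLayersMatrix N E.layer g.1) *ᵥ pauliCoeff A := by
  ext P
  rw [← mulVec_mulVec, ← pauliCoeff_noisyLayers, CircuitDistribution.circuit,
    pauliCoeff_conj_tensor]
  rfl

theorem continuous_pauliCoeff_circuit (A : Op n) (P : Fin n → Fin 4) :
    Continuous fun g => pauliCoeff (E.circuit N g A) P := by
  simp only [pauliCoeff_circuit]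
  have : Continuous fun g : E.Gates =>
      (localMatrix g.2 * noisyLayersMatrix N E.layer g.1) *ᵥ pauliCoeff A :=
    ((continuous_localMatrix.comp continuous_snd).matrix_mul
      ((continuous_noisyLayersMatrix N _).comp continuous_fst)).matrix_mulVec continuous_const
  exact (continuous_apply P).comp this

/-- Since `(1 ± P)² = 2 (1 ± P)`, positivity of `(1 ± P) ρ (1 ± P)` gives `1 ± Tr(P ρ) ≥ 0` in the
order of `ℂ`, which also forces the coefficient to be real. -/
theorem norm_pauliCoeff_le_one {ρ : Op n} (hρ : IsState ρ) (P : Fin n → Fin 4) :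
    ‖pauliCoeff ρ P‖ ≤ 1 := by
  have h : ∀ ε : ℂ, star ε = ε → ε * ε = 1 → 0 ≤ 1 + ε * pauliCoeff ρ P := by
    intro ε h1 h2
    have hB : (1 + ε • pauliString P)ᴴ = 1 + ε • pauliString P := by
      rw [conjTranspose_add, conjTranspose_one, conjTranspose_smul, conjTranspose_pauliString, h1]
    have hpos := (hρ.1.mul_mul_conjTranspose_same (1 + ε • pauliString P)).trace_nonneg
    have e : ((1 + ε • pauliString P) * ρ * (1 + ε • pauliString P)ᴴ).trace =
        2 * (1 + ε * pauliCoeff ρ P) := by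
      rw [hB, Matrix.mul_assoc, trace_mul_comm, Matrix.mul_assoc, trace_mul_comm]
      have : (1 + ε • pauliString P) * (1 + ε • pauliString P) =
          (2 : ℂ) • (1 + ε • pauliString P) := by
        rw [mul_add, mul_one, add_mul, one_mul, smul_mul_smul_comm, pauliString_mul_self, h2,
          one_smul, two_smul]
        abel
      rw [this, smul_mul_assoc, trace_smul, add_mul, one_mul, smul_mul_assoc, trace_add,
        trace_smul, hρ.2, pauliCoeff, smul_eq_mul, smul_eq_mul]
    rw [e] at hpos
    exact le_of_mul_le_mul_left (by simpa using hpos) (by norm_num : (0 : ℂ) < 2)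
  have h1 := h 1 (by simp) (by simp)
  have h2 := h (-1) (by simp) (by simp)
  rw [Complex.le_def] at h1 h2
  simp at h1 h2
  have him : pauliCoeff ρ P = ((pauliCoeff ρ P).re : ℂ) :=
    Complex.ext rfl (by simpa using h1.2.symm)
  rw [him, Complex.norm_real, Real.norm_eq_abs, abs_le]
  exact ⟨by linarith [h1.1], by linarith [h2.1]⟩

/-- The mean square of a Pauli coefficient of the difference of the outputs. -/
theorem integral_norm_sq_pauliCoeff_le (E : CircuitDistribution n (L + 1))
    (hN : ∀ A, (N A).trace = A.trace) (hc : contraction N ≤ 1) {ρ σ : Op n} (hρ : IsState ρ)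
    (hσ : IsState σ) (P : Fin n → Fin 4) :
    ∫ g, ‖pauliCoeff (E.circuit N g ρ - E.circuit N g σ) P‖ ^ 2 ∂E.measure ≤
      4 * contraction N ^ L * contraction N ^ pauliWeight P := by
  set v := pauliCoeff (ρ - σ) with hv
  -- The initial second moment is `v v†`. Its diagonal is at most `4`, as each state contributes at
  -- most `1` to a coefficient, and it vanishes at the identity because the traces agree.
  have hA : IsBoundedBy 4 (vecMulVec v (star v)) := by
    have hd : ∀ Q, diagRe (vecMulVec v (star v)) Q = ‖v Q‖ ^ 2 := by
      intro Q
      rw [diagRe, vecMulVec_apply, Pi.star_apply, Complex.star_def, Complex.mul_conj,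
        Complex.normSq_eq_norm_sq, Complex.ofReal_re]
    refine ⟨?_, fun Q => ?_⟩
    · rw [hd, hv, pauliCoeff_zero, trace_sub, hρ.2, hσ.2]
      simp
    · rw [twirl, mulVec, dotProduct]
      calc _ ≤ ∑ Q', twirlKernel n Q Q' * 4 := by
            refine Finset.sum_le_sum fun Q' _ =>
              mul_le_mul_of_nonneg_left ?_ (twirlKernel_nonneg _ _)
            rw [hd, hv, pauliCoeff_sub]
            have h2 : ‖pauliCoeff ρ Q' - pauliCoeff σ Q'‖ ≤ 2 :=
              (norm_sub_le _ _).trans (by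
                linarith [norm_pauliCoeff_le_one hρ Q', norm_pauliCoeff_le_one hσ Q'])
            nlinarith [norm_nonneg (pauliCoeff ρ Q' - pauliCoeff σ Q')]
        _ = 4 := by rw [← Finset.sum_mul, sum_twirlKernel, one_mul]
  have h := twirl_noisyLayers_le hN hc E.layer (by norm_num) hA P
  rw [← diagRe_secondMoment_local E.final_isTwoDesign,
    ← secondMoment_prod_swap (continuous_noisyLayersMatrix N _) continuous_localMatrix] at h
  refine le_trans (le_of_eq ?_) h
  have e : ∀ g : E.Gates, (localMatrix g.2 * noisyLayersMatrix N E.layer g.1 *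
      vecMulVec v (star v) * (localMatrix g.2 * noisyLayersMatrix N E.layer g.1)ᴴ) P P =
      ((‖pauliCoeff (E.circuit N g ρ - E.circuit N g σ) P‖ ^ 2 : ℝ) : ℂ) := by
    intro g
    rw [pauliCoeff_sub, pauliCoeff_circuit, pauliCoeff_circuit, ← Pi.sub_apply, ← mulVec_sub]
    have : pauliCoeff ρ - pauliCoeff σ = v := by
      ext Q; rw [hv, pauliCoeff_sub, Pi.sub_apply]
    rw [this, mul_vecMulVec, vecMulVec_mul, vecMulVec_apply, ← star_mulVec, Pi.star_apply,
      Complex.star_def, Complex.mul_conj, Complex.normSq_eq_norm_sq]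
  simp only [diagRe, secondMoment, Matrix.of_apply]
  have h3 := integral_congr_ae (μ := E.measure) (Filter.Eventually.of_forall e)
  have h4 := h3.trans (integral_ofReal (𝕜 := ℂ))
  exact (congrArg Complex.re h4).symm

end Layers

/-! ### The contraction coefficient is below one and equals the noise parameter -/

section Channel

/-- The squared Frobenius norm. -/
def frobSq {d : Type} [Fintype d] (A : Matrix d d ℂ) : ℝ := ∑ i, ∑ j, ‖A i j‖ ^ 2

section

variable {d : Type} [Fintype d]

theorem trace_conjTranspose_mul_self (A : Matrix d d ℂ) :
    (Aᴴ * A).trace = (frobSq A : ℂ) := by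
  rw [frobSq, Finset.sum_comm]
  push_cast
  simp only [trace, diag, Matrix.mul_apply, conjTranspose_apply]
  refine Finset.sum_congr rfl fun i _ => Finset.sum_congr rfl fun j _ => ?_
  rw [Complex.star_def, ← Complex.normSq_eq_conj_mul_self, Complex.normSq_eq_norm_sq]
  push_cast
  rfl

theorem frobSq_conj_unitary [DecidableEq d] {U : Matrix d d ℂ} (hU : Uᴴ * U = 1)
    (A : Matrix d d ℂ) : frobSq (U * A * Uᴴ) = frobSq A := by
  have h : ((frobSq (U * A * Uᴴ) : ℝ) : ℂ) = (frobSq A : ℝ) := by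
    rw [← trace_conjTranspose_mul_self, ← trace_conjTranspose_mul_self]
    have : (U * A * Uᴴ)ᴴ * (U * A * Uᴴ) = U * (Aᴴ * (Uᴴ * U) * A * Uᴴ) := by
      simp only [conjTranspose_mul, conjTranspose_conjTranspose, Matrix.mul_assoc]
    rw [this, hU, trace_mul_comm, Matrix.mul_one, Matrix.mul_assoc, hU, Matrix.mul_one]
  exact_mod_cast h

variable [DecidableEq d]

theorem sum_eigenvalues_sq {J : Matrix d d ℂ} (hJ : J.IsHermitian) :
    ∑ i, hJ.eigenvalues i ^ 2 = frobSq J := by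
  have h : ((∑ i, hJ.eigenvalues i ^ 2 : ℝ) : ℂ) = (frobSq J : ℂ) := by
    rw [← trace_conjTranspose_mul_self, hJ.eq]
    have hs := hJ.spectral_theorem
    rw [Unitary.conjStarAlgAut_apply] at hs
    set U : Matrix d d ℂ := hJ.eigenvectorUnitary.val
    have hU : star U * U = 1 := Unitary.coe_star_mul_self hJ.eigenvectorUnitary
    set Λ : Matrix d d ℂ := diagonal (RCLike.ofReal ∘ hJ.eigenvalues) with hΛ
    have : J * J = U * (Λ * Λ * star U) := by
      conv_lhs => rw [hs]
      calc U * Λ * star U * (U * Λ * star U) = U * Λ * (star U * U) * Λ * star U := by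
            simp only [Matrix.mul_assoc]
        _ = _ := by rw [hU]; simp only [Matrix.mul_one, Matrix.mul_assoc]
    rw [this, trace_mul_comm, Matrix.mul_assoc, hU, Matrix.mul_one, hΛ, diagonal_mul_diagonal,
      trace_diagonal]
    push_cast
    exact Finset.sum_congr rfl fun i _ => sq _
  exact_mod_cast h

theorem sum_eigenvalues_eq {J : Matrix d d ℂ} (hJ : J.IsHermitian) {τ : ℝ} (hτ : J.trace = τ) :
    ∑ i, hJ.eigenvalues i = τ := by
  have h : ((∑ i, hJ.eigenvalues i : ℝ) : ℂ) = τ := by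
    rw [← hτ, hJ.trace_eq_sum_eigenvalues, Complex.ofReal_sum]
    rfl
  exact_mod_cast h

theorem sum_sq_add_sum_ne {f : d → ℝ} :
    (∑ i, f i) ^ 2 = ∑ i, f i ^ 2 + ∑ i, ∑ j ∈ Finset.univ.erase i, f i * f j := by
  rw [sq, Finset.sum_mul_sum, ← Finset.sum_add_distrib]
  refine Finset.sum_congr rfl fun i _ => ?_
  rw [← Finset.add_sum_erase _ _ (Finset.mem_univ i), sq]

/-- The purity of a positive semidefinite matrix is at most its squared trace. -/
theorem frobSq_le_trace_sq {J : Matrix d d ℂ} (hJ : J.PosSemidef) {τ : ℝ} (hτ : J.trace = τ) :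
    frobSq J ≤ τ ^ 2 := by
  rw [← sum_eigenvalues_sq hJ.isHermitian, ← sum_eigenvalues_eq hJ.isHermitian hτ,
    sum_sq_add_sum_ne]
  exact le_add_of_nonneg_right (Finset.sum_nonneg fun i _ => Finset.sum_nonneg fun j _ =>
    mul_nonneg (hJ.eigenvalues_nonneg i) (hJ.eigenvalues_nonneg j))

/-- A positive semidefinite matrix of maximal purity has rank one. -/
theorem exists_eq_vecMulVec_of_frobSq_eq {J : Matrix d d ℂ} (hJ : J.PosSemidef) {τ : ℝ}
    (hτ : J.trace = τ) (h : frobSq J = τ ^ 2) : ∃ v : d → ℂ, J = vecMulVec v (star v) := by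
  rw [← sum_eigenvalues_sq hJ.isHermitian, ← sum_eigenvalues_eq hJ.isHermitian hτ,
    sum_sq_add_sum_ne] at h
  set lam := hJ.isHermitian.eigenvalues
  have hn : ∀ i, 0 ≤ lam i := hJ.eigenvalues_nonneg
  -- Equality makes a sum of nonnegative cross terms vanish, so at most one eigenvalue is nonzero.
  have h0 : ∀ i j, j ≠ i → lam i * lam j = 0 := by
    have h1 : ∑ i, ∑ j ∈ Finset.univ.erase i, lam i * lam j = 0 := by linarith
    rw [Finset.sum_eq_zero_iff_of_nonneg fun i _ => Finset.sum_nonneg fun j _ =>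
      mul_nonneg (hn i) (hn j)] at h1
    intro i j hij
    have h2 := h1 i (Finset.mem_univ i)
    rw [Finset.sum_eq_zero_iff_of_nonneg fun j _ => mul_nonneg (hn i) (hn j)] at h2
    exact h2 j (Finset.mem_erase.mpr ⟨hij, Finset.mem_univ j⟩)
  have hs := hJ.isHermitian.spectral_theorem
  rw [Unitary.conjStarAlgAut_apply] at hs
  set U : Matrix d d ℂ := hJ.isHermitian.eigenvectorUnitary.val
  have hent : ∀ x y, J x y = ∑ k, U x k * (lam k : ℂ) * star (U y k) := by
    intro x y
    conv_lhs => rw [hs]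
    rw [Matrix.mul_apply]
    refine Finset.sum_congr rfl fun k _ => ?_
    rw [mul_diagonal]
    rfl
  by_cases hz : ∀ i, lam i = 0
  · refine ⟨0, ?_⟩
    ext x y
    rw [hent]
    simp [hz]
  · push Not at hz
    obtain ⟨i, hi⟩ := hz
    -- The eigenvector of the only nonzero eigenvalue, scaled by its square root.
    refine ⟨fun x => (Real.sqrt (lam i) : ℂ) * U x i, ?_⟩
    ext x y
    have hstar : star ((Real.sqrt (lam i) : ℂ) * U y i) = (Real.sqrt (lam i) : ℂ) * star (U y i) := by
      rw [star_mul', Complex.star_def, Complex.conj_ofReal]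
    rw [hent, Finset.sum_eq_single i, vecMulVec_apply, Pi.star_apply, hstar]
    · have : (lam i : ℂ) = (Real.sqrt (lam i) : ℂ) * (Real.sqrt (lam i) : ℂ) := by
        rw [← Complex.ofReal_mul, Real.mul_self_sqrt (hn i)]
      rw [this]
      ring
    · intro k _ hk
      have : lam k = 0 := (mul_eq_zero.mp (h0 i k hk)).resolve_left hi
      rw [this]
      simp
    · simp

end

variable {N : Matrix (Fin 2) (Fin 2) ℂ →ₗ[ℂ] Matrix (Fin 2) (Fin 2) ℂ}

/-- The Choi matrix of a single-qubit map. -/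
def choiMatrix (N : Matrix (Fin 2) (Fin 2) ℂ →ₗ[ℂ] Matrix (Fin 2) (Fin 2) ℂ) :
    Matrix (Fin 2 × Fin 2) (Fin 2 × Fin 2) ℂ :=
  Matrix.of fun p q => N (Matrix.single p.2 q.2 1) p.1 q.1

/-- Complete positivity with a two-dimensional ancilla, applied to the projector on the unnormalised
maximally entangled vector. -/
theorem IsChannel.posSemidef_choiMatrix (hN : IsChannel N) : (choiMatrix N).PosSemidef := by
  set w : Fin 2 × Fin 2 → ℂ := fun p => if p.1 = p.2 then 1 else 0 with hw
  have h := hN.completely_positive 2 _ (posSemidef_vecMulVec_self_star w)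
  convert h using 1
  ext p q
  rw [choiMatrix, ampliate, Matrix.of_apply, Matrix.of_apply]
  refine congrFun (congrFun (congrArg N ?_) _) _
  ext i j
  simp only [Matrix.single_apply, Matrix.of_apply, vecMulVec_apply, hw, Pi.star_apply]
  split_ifs <;> simp_all

theorem IsChannel.trace_choiMatrix (hN : IsChannel N) : (choiMatrix N).trace = (2 : ℝ) := by
  have h : (choiMatrix N).trace = ∑ x, (N (Matrix.single x x 1)).trace := by
    simp only [trace, diag, choiMatrix, Matrix.of_apply, Fintype.sum_prod_type]
    rw [Finset.sum_comm]
  rw [h]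
  simp [hN.trace_preserving]

theorem map_apply_eq_sum (A : Matrix (Fin 2) (Fin 2) ℂ) (i j : Fin 2) :
    N A i j = ∑ x, ∑ y, A x y * N (Matrix.single x y 1) i j := by
  conv_lhs => rw [matrix_eq_sum_single A]
  simp only [map_sum, Matrix.sum_apply]
  refine Finset.sum_congr rfl fun x _ => Finset.sum_congr rfl fun y _ => ?_
  have : Matrix.single x y (A x y) = A x y • Matrix.single x y (1 : ℂ) := by
    rw [Matrix.smul_single, smul_eq_mul, mul_one]
  rw [this, map_smul, Matrix.smul_apply, smul_eq_mul]

/-- A channel whose Choi matrix has rank one is unitary. -/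
theorem IsChannel.isUnitaryChannel_of_choiMatrix_eq (hN : IsChannel N) {v : Fin 2 × Fin 2 → ℂ}
    (hv : choiMatrix N = vecMulVec v (star v)) : IsUnitaryChannel N := by
  -- Reshaped to a matrix, the vector is the single Kraus operator; trace preservation on matrix
  -- units then makes it an isometry.
  set K : Matrix (Fin 2) (Fin 2) ℂ := Matrix.of fun i x => v (i, x) with hK
  have hNK : ∀ A, N A = K * A * Kᴴ := by
    intro A
    ext i j
    rw [map_apply_eq_sum, mul_mul_conjTranspose_apply]
    refine Finset.sum_congr rfl fun x _ => Finset.sum_congr rfl fun y _ => ?_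
    have : N (Matrix.single x y 1) i j = choiMatrix N (i, x) (j, y) := rfl
    rw [this, hv, vecMulVec_apply, mul_comm]
    rfl
  have hKK : Kᴴ * K = 1 := by
    ext x y
    have h := hN.trace_preserving (Matrix.single y x 1)
    rw [hNK, trace_mul_comm, ← Matrix.mul_assoc, Matrix.trace_mul_single] at h
    rw [MulOpposite.op_one, one_smul] at h
    rw [h, Matrix.one_apply]
    split_ifs with hxy
    · rw [hxy, Matrix.trace_single_eq_same]
    · rw [Matrix.trace_single_eq_of_ne _ _ _ (Ne.symm hxy)]
  exact ⟨⟨K, mem_unitaryGroup_iff'.mpr hKK⟩, hNK⟩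

/-! ### The contraction coefficient -/

theorem sum_norm_sq_trace_pauli (A : Matrix (Fin 2) (Fin 2) ℂ) :
    ∑ p, ‖(pauli p * A).trace‖ ^ 2 = 2 * frobSq A := by
  have h := sum_trace_mul_star_of_complete isPauliBasis_pauli.herm isPauliBasis_pauli.complete A
  rw [trace_conjTranspose_mul_self, Fintype.card_fin] at h
  simp only [Complex.star_def, Complex.mul_conj, Complex.normSq_eq_norm_sq] at h
  exact_mod_cast h

/-- The sum of the squared values of a linear functional does not depend on the orthogonal
operator basis. -/
theorem sum_norm_sq_functional_pauli (f : Matrix (Fin 2) (Fin 2) ℂ →ₗ[ℂ] ℂ)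
    {V : Matrix (Fin 2) (Fin 2) ℂ} (hV : Vᴴ * V = 1) :
    ∑ q, ‖f (Vᴴ * pauli q * V)‖ ^ 2 = 2 * ∑ x, ∑ y, ‖f (Matrix.single x y 1)‖ ^ 2 := by
  -- `B` represents `f` through the trace pairing; Parseval is then applied to `V B V†`, whose
  -- Frobenius norm is that of `B`.
  set B : Matrix (Fin 2) (Fin 2) ℂ := Matrix.of fun y x => f (Matrix.single x y 1) with hB
  have hf : ∀ A, f A = (A * B).trace := by
    intro A
    conv_lhs => rw [matrix_eq_sum_single A]
    simp only [map_sum, trace, diag, Matrix.mul_apply, hB, Matrix.of_apply]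
    refine Finset.sum_congr rfl fun x _ => Finset.sum_congr rfl fun y _ => ?_
    have : Matrix.single x y (A x y) = A x y • Matrix.single x y (1 : ℂ) := by
      rw [Matrix.smul_single, smul_eq_mul, mul_one]
    rw [this, map_smul, smul_eq_mul]
  have h1 : ∀ q, f (Vᴴ * pauli q * V) = (pauli q * (V * B * Vᴴ)).trace := by
    intro q
    rw [hf, Matrix.mul_assoc, Matrix.mul_assoc, trace_mul_comm]
    simp only [Matrix.mul_assoc]
  simp only [h1]
  rw [sum_norm_sq_trace_pauli, frobSq_conj_unitary hV, frobSq, Finset.sum_comm]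
  rfl

/-- The squared Frobenius norm of the Pauli transfer matrix is that of the Choi matrix, and
invariant under unitary changes of the input and output bases. -/
theorem sum_norm_sq_transferMatrix_of_conj
    {N' : Matrix (Fin 2) (Fin 2) ℂ →ₗ[ℂ] Matrix (Fin 2) (Fin 2) ℂ}
    {U V : Matrix (Fin 2) (Fin 2) ℂ} (hU : Uᴴ * U = 1) (hV : Vᴴ * V = 1)
    (h : ∀ A, N A = U * N' (Vᴴ * A * V) * Uᴴ) :
    ∑ p, ∑ q, ‖transferMatrix N p q‖ ^ 2 = frobSq (choiMatrix N') := by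
  have h1 : ∀ q, ∑ p, ‖transferMatrix N p q‖ ^ 2 =
      1 / 2 * ∑ i, ∑ j, ‖N' (Vᴴ * pauli q * V) i j‖ ^ 2 := by
    intro q
    have h2 := sum_norm_sq_trace_pauli (N (pauli q))
    rw [h, frobSq_conj_unitary hU, ← h] at h2
    simp only [transferMatrix, norm_div, div_pow, ← Finset.sum_div, h2, frobSq]
    norm_num
    ring
  rw [Finset.sum_comm]
  simp only [h1, ← Finset.mul_sum]
  have h3 : ∀ i j, ∑ q, ‖N' (Vᴴ * pauli q * V) i j‖ ^ 2 =
      2 * ∑ x, ∑ y, ‖N' (Matrix.single x y 1) i j‖ ^ 2 := fun i j =>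
    sum_norm_sq_functional_pauli ((Matrix.entryLinearMap ℂ ℂ i j).comp N') hV
  have h4 : ∑ q, ∑ i, ∑ j, ‖N' (Vᴴ * pauli q * V) i j‖ ^ 2 =
      2 * ∑ i, ∑ j, ∑ x, ∑ y, ‖N' (Matrix.single x y 1) i j‖ ^ 2 := by
    rw [Finset.sum_comm, Finset.mul_sum]
    refine Finset.sum_congr rfl fun i _ => ?_
    rw [Finset.sum_comm, Finset.mul_sum]
    exact Finset.sum_congr rfl fun j _ => h3 i j
  rw [h4, ← mul_assoc, one_div, inv_mul_cancel₀ two_ne_zero, one_mul]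
  simp only [frobSq, choiMatrix, Matrix.of_apply, Fintype.sum_prod_type]
  exact Finset.sum_congr rfl fun i _ => Finset.sum_comm

theorem sum_norm_sq_transferMatrix
    (N : Matrix (Fin 2) (Fin 2) ℂ →ₗ[ℂ] Matrix (Fin 2) (Fin 2) ℂ) :
    ∑ p, ∑ q, ‖transferMatrix N p q‖ ^ 2 = frobSq (choiMatrix N) :=
  sum_norm_sq_transferMatrix_of_conj (U := 1) (V := 1) (by simp) (by simp) (by simp)

/-- By trace preservation the row of the identity is a unit vector; the other three rows make up
`3c`. -/
theorem one_add_three_mul_contraction (hN : ∀ A, (N A).trace = A.trace) :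
    1 + 3 * contraction N = ∑ p, ∑ q, ‖transferMatrix N p q‖ ^ 2 := by
  have h0 : ∑ q, ‖transferMatrix N 0 q‖ ^ 2 = 1 := by
    simp [transferMatrix_zero_left hN, apply_ite]
  rw [← Finset.add_sum_erase _ _ (Finset.mem_univ 0), h0, contraction]
  ring

/-- Every channel that is not unitary strictly contracts. -/
theorem IsChannel.contraction_lt_one (hN : IsChannel N) (hu : ¬IsUnitaryChannel N) :
    contraction N < 1 := by
  have h := one_add_three_mul_contraction hN.trace_preserving
  rw [sum_norm_sq_transferMatrix] at h
  have hle := frobSq_le_trace_sq hN.posSemidef_choiMatrix hN.trace_choiMatrix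
  have hne : frobSq (choiMatrix N) ≠ 2 ^ 2 := by
    intro he
    obtain ⟨v, hv⟩ := exists_eq_vecMulVec_of_frobSq_eq hN.posSemidef_choiMatrix
      hN.trace_choiMatrix he
    exact hu (hN.isUnitaryChannel_of_choiMatrix_eq hv)
  have hlt := lt_of_le_of_ne hle hne
  linarith

/-- The noise parameter of a normal form is the contraction coefficient of the channel. -/
theorem IsNormalForm.noiseParam_eq (hN : IsChannel N) {t D : Fin 3 → ℝ} (h : IsNormalForm N t D) :
    noiseParam t D = contraction N := by
  obtain ⟨U, V, N', -, hconj, h1, hD⟩ := h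
  -- Both sides are the squared norm of a transfer matrix, of `N` and of `N'`; the latter has only
  -- the entries `1`, `t` in its first column and `D` on the diagonal.
  have key : 1 + 3 * contraction N = 1 + 3 * noiseParam t D := by
    rw [one_add_three_mul_contraction hN.trace_preserving,
      sum_norm_sq_transferMatrix_of_conj (mem_unitaryGroup_iff'.mp U.2)
        (mem_unitaryGroup_iff'.mp V.2) hconj, ← sum_norm_sq_transferMatrix]
    have hcol : ∀ p, transferMatrix N' p 0 =
        (if p = 0 then 1 else 0) + ∑ q : Fin 3, (t q : ℂ) * if p = q.succ then 1 else 0 := by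
      intro p
      rw [transferMatrix, isPauliBasis_pauli.zero, h1, Matrix.mul_add, trace_add, Finset.mul_sum,
        trace_sum, ← isPauliBasis_pauli.zero, isPauliBasis_pauli.trace_mul]
      simp only [mul_smul_comm, trace_smul, isPauliBasis_pauli.trace_mul, Fintype.card_fin,
        smul_eq_mul, add_div, Finset.sum_div]
      congr 1
      · split_ifs <;> simp
      · exact Finset.sum_congr rfl fun q _ => by split_ifs <;> simp
    have hcol' : ∀ p (q : Fin 3), transferMatrix N' p q.succ =
        (D q : ℂ) * if p = q.succ then 1 else 0 := by
      intro p q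
      rw [transferMatrix, hD, mul_smul_comm, trace_smul, isPauliBasis_pauli.trace_mul]
      split_ifs <;> simp
    have h00 : transferMatrix N' 0 0 = 1 := by
      rw [hcol]; simp [(Fin.succ_ne_zero _).symm]
    have hs0 : ∀ p : Fin 3, transferMatrix N' p.succ 0 = t p := by
      intro p; rw [hcol]; simp [Fin.succ_ne_zero]
    have h0s : ∀ q : Fin 3, transferMatrix N' 0 q.succ = 0 := by
      intro q; rw [hcol']; simp [(Fin.succ_ne_zero _).symm]
    have hss : ∀ p q : Fin 3, ‖transferMatrix N' p.succ q.succ‖ ^ 2 =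
        if p = q then D q ^ 2 else 0 := by
      intro p q
      simp only [hcol', Fin.succ_inj]
      split_ifs <;> simp
    rw [Fin.sum_univ_succ]
    simp only [Fin.sum_univ_succ (n := 3), h00, hs0, h0s, hss, Finset.sum_add_distrib,
      Finset.sum_ite_eq, Finset.mem_univ, if_true, norm_one, norm_zero, Complex.norm_real,
      Real.norm_eq_abs, sq_abs]
    simp only [one_pow, ne_eq, OfNat.ofNat_ne_zero, not_false_eq_true, zero_pow,
      Finset.sum_const_zero, add_zero, noiseParam]
    ring
  linarith

end Channel

/-! ### From mean squares to expectation values and trace norms -/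

section Final

variable {n L : ℕ} {N : Matrix (Fin 2) (Fin 2) ℂ →ₗ[ℂ] Matrix (Fin 2) (Fin 2) ℂ}

/-- The variance is nonnegative. -/
theorem integral_le_sqrt_integral_sq {Ω : Type} [MeasurableSpace Ω] [TopologicalSpace Ω]
    [CompactSpace Ω] [OpensMeasurableSpace Ω] (μ : Measure Ω) [IsProbabilityMeasure μ] {f : Ω → ℝ}
    (hf : Continuous f) : ∫ ω, f ω ∂μ ≤ Real.sqrt (∫ ω, f ω ^ 2 ∂μ) := by
  apply Real.le_sqrt_of_sq_le
  set m := ∫ ω, f ω ∂μ with hm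
  have h : 0 ≤ ∫ ω, (f ω - m) ^ 2 ∂μ := integral_nonneg fun ω => sq_nonneg _
  have e : ∀ ω, (f ω - m) ^ 2 = f ω ^ 2 - 2 * m * f ω + m ^ 2 := fun ω => by ring
  simp only [e] at h
  have i1 : Integrable (fun ω => f ω ^ 2) μ := integrable_of_continuous (hf.pow 2)
  have i2 : Integrable (fun ω => 2 * m * f ω) μ := (integrable_of_continuous hf).const_mul _
  have i3 : Integrable (fun ω => f ω ^ 2 - 2 * m * f ω) μ := i1.sub i2
  rw [integral_add i3 (integrable_const _), integral_sub i1 i2, integral_const_mul,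
    ← hm] at h
  simp at h
  linarith

theorem traceNorm_nonneg {d : Type} [Fintype d] [DecidableEq d] (A : Matrix d d ℂ) :
    0 ≤ traceNorm A := Finset.sum_nonneg fun _ _ => Real.sqrt_nonneg _

/-- Cauchy–Schwarz over the singular values, whose squares sum to `Tr(A† A)`. -/
theorem traceNorm_le {d : Type} [Fintype d] [DecidableEq d] (A : Matrix d d ℂ) :
    traceNorm A ≤ Real.sqrt (Fintype.card d * frobSq A) := by
  apply Real.le_sqrt_of_sq_le
  refine (sq_sum_le_card_mul_sum_sq).trans (le_of_eq ?_)
  rw [Finset.card_univ]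
  congr 1
  rw [← sum_eigenvalues_eq (isHermitian_conjTranspose_mul_self A) (trace_conjTranspose_mul_self A)]
  exact Finset.sum_congr rfl fun i _ =>
    Real.sq_sqrt ((posSemidef_conjTranspose_mul_self A).eigenvalues_nonneg i)

theorem traceNorm_le_pauliCoeff (A : Op n) :
    traceNorm A ≤ Real.sqrt (∑ P, ‖pauliCoeff A P‖ ^ 2) := by
  refine (traceNorm_le A).trans_eq ?_
  congr 1
  have h := sum_pauliCoeff_mul_star A
  rw [trace_conjTranspose_mul_self] at h
  simp only [Complex.star_def, Complex.mul_conj, Complex.normSq_eq_norm_sq] at h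
  simp only [Fintype.card_fun, Fintype.card_fin]
  exact_mod_cast h.symm

theorem integral_norm_pauliCoeff_le (E : CircuitDistribution n (L + 1))
    (hN : ∀ A, (N A).trace = A.trace) (hc : contraction N ≤ 1) {ρ σ : Op n} (hρ : IsState ρ)
    (hσ : IsState σ) (P : Fin n → Fin 4) :
    ∫ g, ‖pauliCoeff (E.circuit N g ρ) P - pauliCoeff (E.circuit N g σ) P‖ ∂E.measure ≤
      2 * Real.sqrt (contraction N) ^ (L + pauliWeight P) := by
  have h := integral_norm_sq_pauliCoeff_le E hN hc hρ hσ P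
  simp only [pauliCoeff_sub] at h
  refine (integral_le_sqrt_integral_sq E.measure
    (((continuous_pauliCoeff_circuit E ρ P).sub (continuous_pauliCoeff_circuit E σ P)).norm)).trans
    ((Real.sqrt_le_sqrt h).trans (Real.sqrt_le_iff.mpr ⟨by positivity, le_of_eq ?_⟩))
  rw [mul_pow, ← pow_mul, mul_comm _ 2, pow_mul, Real.sq_sqrt (contraction_nonneg N), pow_add]
  ring

/-- The gain from the weight is dropped, so each of the `4 ^ n` strings contributes at most `4 c ^
L`; the square root gives `2 ^ (n + 1)`. -/
theorem integral_traceNorm_le (E : CircuitDistribution n (L + 1))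
    (hN : ∀ A, (N A).trace = A.trace) (hc : contraction N ≤ 1) {ρ σ : Op n} (hρ : IsState ρ)
    (hσ : IsState σ) :
    ∫ g, traceNorm (E.circuit N g ρ - E.circuit N g σ) ∂E.measure ≤
      2 ^ (n + 1) * Real.sqrt (contraction N) ^ L := by
  have hcont : ∀ P, Continuous fun g =>
      ‖pauliCoeff (E.circuit N g ρ - E.circuit N g σ) P‖ ^ 2 := fun P => by
    simp only [pauliCoeff_sub]
    exact ((continuous_pauliCoeff_circuit E ρ P).sub
      (continuous_pauliCoeff_circuit E σ P)).norm.pow 2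
  have hcont' : Continuous fun g =>
      Real.sqrt (∑ P, ‖pauliCoeff (E.circuit N g ρ - E.circuit N g σ) P‖ ^ 2) :=
    (continuous_finsetSum _ fun P _ => hcont P).sqrt
  -- Only the continuous majorant has to be integrable; no regularity of the trace norm is needed.
  have h1 : ∫ g, traceNorm (E.circuit N g ρ - E.circuit N g σ) ∂E.measure ≤
      ∫ g, Real.sqrt (∑ P, ‖pauliCoeff (E.circuit N g ρ - E.circuit N g σ) P‖ ^ 2) ∂E.measure :=
    integral_mono_of_nonneg (Filter.Eventually.of_forall fun g => traceNorm_nonneg _)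
      (integrable_of_continuous hcont') (Filter.Eventually.of_forall fun g =>
        traceNorm_le_pauliCoeff _)
  refine h1.trans ((integral_le_sqrt_integral_sq E.measure hcont').trans ?_)
  refine Real.sqrt_le_iff.mpr ⟨by positivity, ?_⟩
  have e : ∀ g, Real.sqrt (∑ P, ‖pauliCoeff (E.circuit N g ρ - E.circuit N g σ) P‖ ^ 2) ^ 2 =
      ∑ P, ‖pauliCoeff (E.circuit N g ρ - E.circuit N g σ) P‖ ^ 2 := fun g =>
    Real.sq_sqrt (Finset.sum_nonneg fun _ _ => sq_nonneg _)
  simp only [e]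
  rw [integral_finsetSum _ fun P _ => integrable_of_continuous (hcont P)]
  calc _ ≤ ∑ _P : Fin n → Fin 4, 4 * contraction N ^ L := by
        refine Finset.sum_le_sum fun P _ =>
          (integral_norm_sq_pauliCoeff_le E hN hc hρ hσ P).trans ?_
        exact mul_le_of_le_one_right (mul_nonneg (by norm_num) (pow_nonneg (contraction_nonneg N) _))
          (pow_le_one₀ (contraction_nonneg N) hc)
    _ = 4 ^ n * (4 * contraction N ^ L) := by
        simp
    _ = _ := by
        rw [mul_pow, ← pow_mul, ← pow_mul, mul_comm (n + 1) 2, mul_comm L 2, pow_mul, pow_mul,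
          Real.sq_sqrt (contraction_nonneg N), pow_succ]
        norm_num
        ring

theorem IsState.eq_of_isEmpty {ρ σ : Op 0} (hρ : IsState ρ) (hσ : IsState σ) : ρ = σ := by
  have h := hρ.2.trans hσ.2.symm
  simp only [trace, diag, Fintype.sum_unique] at h
  ext x y
  convert h

theorem sqrt_contraction_lt_exp (hc : contraction N < 1) :
    ∃ r > (0 : ℝ), Real.sqrt (contraction N) ≤ Real.exp (-r) := by
  have h1 : Real.sqrt (contraction N) < 1 := by
    rw [Real.sqrt_lt' one_pos]; simpa using hc
  -- The maximum with `1 / 2` covers a vanishing contraction coefficient, for which the logarithm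
  -- would be of no use.
  have h2 : 0 < max (Real.sqrt (contraction N)) (1 / 2) := lt_max_of_lt_right (by norm_num)
  refine ⟨-Real.log (max (Real.sqrt (contraction N)) (1 / 2)), ?_, ?_⟩
  · exact neg_pos.mpr (Real.log_neg h2 (max_lt h1 (by norm_num)))
  · rw [neg_neg, Real.exp_log h2]
    exact le_max_left _ _

end Final

end NoisyCircuit

end

theorem mainTheorem5
    (N : Matrix (Fin 2) (Fin 2) ℂ →ₗ[ℂ] Matrix (Fin 2) (Fin 2) ℂ)
    (hN : IsChannel N) (hN_not_unitary : ¬ IsUnitaryChannel N) :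
    -- average distance of Pauli expectation values: `exp (-Ω(L + |P|))`
    (∃ a > (0 : ℝ), ∃ m₀ : ℕ, ∀ (n L : ℕ), 1 ≤ L →
      ∀ (E : CircuitDistribution n L) (P : Fin n → Fin 4) (ρ σ : Op n),
        IsState ρ → IsState σ → m₀ ≤ L + pauliWeight P →
        ∫ g, ‖(pauliString P * E.circuit N g ρ).trace -
            (pauliString P * E.circuit N g σ).trace‖ ∂E.measure ≤
          Real.exp (-(a * ((L : ℝ) + pauliWeight P)))) ∧
    -- average trace distance at any depth, in terms of the normal form parameters of the noise
    (∀ t D : Fin 3 → ℝ, IsNormalForm N t D →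
      noiseParam t D < 1 ∧
      ∀ (n L : ℕ), 1 ≤ L → ∀ (E : CircuitDistribution n L) (ρ σ : Op n),
        IsState ρ → IsState σ →
        ∫ g, traceNorm (E.circuit N g ρ - E.circuit N g σ) ∂E.measure ≤
          2 ^ (n + 1) * noiseParam t D ^ (((L : ℝ) - 1) / 2)) ∧
    -- average trace distance at linear depth: `exp (-Ω(n))`
    (∃ K > (0 : ℝ), ∃ γ > (0 : ℝ), ∀ (n L : ℕ), 1 ≤ L → K * n ≤ L →
      ∀ (E : CircuitDistribution n L) (ρ σ : Op n), IsState ρ → IsState σ →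
        ∫ g, traceNorm (E.circuit N g ρ - E.circuit N g σ) ∂E.measure ≤
          Real.exp (-(γ * n))) := by
  have hc := hN.contraction_lt_one hN_not_unitary
  have htp := hN.trace_preserving
  obtain ⟨r, hr, hle⟩ := sqrt_contraction_lt_exp hc
  have hpow : ∀ k : ℕ, Real.sqrt (contraction N) ^ k ≤ Real.exp (-(r * k)) := fun k => by
    refine (pow_le_pow_left₀ (Real.sqrt_nonneg _) hle k).trans_eq ?_
    rw [← Real.exp_nat_mul]
    ring_nf
  have htwo : (2 : ℝ) ≤ Real.exp 1 := by
    have := Real.add_one_le_exp (1 : ℝ)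
    linarith
  -- With `2 ≤ e` and `m = L + |P|`, the first bound needs `1 - r (m - 1) ≤ -(r / 2) m`, that is `m
  -- ≥ 2 (1 + r) / r`. The last needs `(n + 1) - r (L - 1) ≤ -n`, which follows from `r L ≥ (3 + r)
  -- n` when `n ≥ 1`.
  refine ⟨⟨r / 2, half_pos hr, ⌈2 * (1 + r) / r⌉₊, ?_⟩, ?_, ⟨(3 + r) / r, by positivity, 1, one_pos, ?_⟩⟩
  · intro n L hL E P ρ σ hρ hσ hm
    obtain ⟨L, rfl⟩ := Nat.exists_eq_succ_of_ne_zero (Nat.one_le_iff_ne_zero.mp hL)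
    refine (integral_norm_pauliCoeff_le E htp hc.le hρ hσ P).trans ?_
    have hm' : 2 * (1 + r) / r ≤ (L : ℝ) + 1 + pauliWeight P := by
      refine (Nat.le_ceil _).trans ?_
      exact_mod_cast hm
    rw [div_le_iff₀ hr] at hm'
    calc _ ≤ Real.exp 1 * Real.exp (-(r * (L + pauliWeight P : ℕ))) :=
          mul_le_mul htwo (hpow _) (by positivity) (by positivity)
      _ ≤ _ := by
          rw [← Real.exp_add, Real.exp_le_exp]
          push_cast
          linarith
  · intro t D h
    rw [h.noiseParam_eq hN]
    refine ⟨hc, fun n L hL E ρ σ hρ hσ => ?_⟩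
    obtain ⟨L, rfl⟩ := Nat.exists_eq_succ_of_ne_zero (Nat.one_le_iff_ne_zero.mp hL)
    refine (integral_traceNorm_le E htp hc.le hρ hσ).trans_eq ?_
    congr 1
    rw [Real.sqrt_eq_rpow, ← Real.rpow_mul_natCast (contraction_nonneg N)]
    congr 1
    push_cast
    ring
  · intro n L hL hKL E ρ σ hρ hσ
    obtain ⟨L, rfl⟩ := Nat.exists_eq_succ_of_ne_zero (Nat.one_le_iff_ne_zero.mp hL)
    -- For `n = 0` the general estimate may exceed the required bound `1`, but there is only one
    -- state.
    rcases Nat.eq_zero_or_pos n with rfl | hn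
    · have h0 : traceNorm (0 : Op 0) = 0 :=
        le_antisymm ((traceNorm_le 0).trans_eq (by simp [frobSq])) (traceNorm_nonneg _)
      rw [hρ.eq_of_isEmpty hσ]
      simp [h0]
    refine (integral_traceNorm_le E htp hc.le hρ hσ).trans ?_
    have hn' : (1 : ℝ) ≤ n := by exact_mod_cast hn
    rw [div_mul_eq_mul_div, div_le_iff₀ hr] at hKL
    push_cast at hKL
    calc _ ≤ Real.exp 1 ^ (n + 1) * Real.exp (-(r * L)) :=
          mul_le_mul (pow_le_pow_left₀ zero_le_two htwo _) (hpow L) (by positivity) (by positivity)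
      _ ≤ _ := by
          rw [← Real.exp_nat_mul, ← Real.exp_add, Real.exp_le_exp]
          push_cast
          nlinarith
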